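/- Let $P\in\mathbb R^{n\times n}$ be symmetric positive semidefinite, $q\in\mathbb R^n$, $G\in\mathbb R^{m\times n}$, $h\in\mathbb R^m$, $A\in\mathbb R^{p\times n}$, $b\in\mathbb R^p$ (no assumption on $G$ or $A$), and let $\mu_I,\mu_E,\sigma_x,\sigma_s,\rho_I,\rho_E>0$ and $\alpha\in(0,2)$. Let $$\phi(x,s)=\tfrac12x^\top Px+q^\top x+\mu_I\|Gx+s-h\|_1+\mu_E\|Ax-b\|_1 ,$$ and assume that $\phi$ is bounded below on $\{(x,s)\in\mathbb R^n\times\mathbb R^m: s\ge 0\}$. Write $\tilde{\boldsymbol x}=(\tilde x,\tilde s,\tilde z_I,\tilde z_E)$ and $\boldsymbol x=(x,s,z_I,z_E)$ for vectors in $\mathbb R^n\times\mathbb R^m\times\mathbb R^m\times\mathbb R^p$, and consider the problem $$\min_{\tilde{\boldsymbol x},\boldsymbol x}\ f(\tilde{\boldsymbol x})+g(\boldsymbol x)\quad\text{subject to}\quad\tilde{\boldsymbol x}=\boldsymbol x ,$$ where $f(\tilde{\boldsymbol x})=\tfrac12\tilde x^\top P\tilde x+q^\top\tilde x$ if $\tilde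 z_I=G\tilde x+\tilde s-h$ and $\tilde z_E=A\tilde x-b$, and $f(\tilde{\boldsymbol x})=+\infty$ otherwise, and $g(\boldsymbol x)=\mu_I\|z_I\|_1+\mu_E\|z_E\|_1$ if $s\ge0$, and $g(\boldsymbol x)=+\infty$ otherwise. With the dual variable $\boldsymbol y=(w_x,w_s,y_I,y_E)$, its Lagrangian is $$\mathcal L(\tilde{\boldsymbol x},\boldsymbol x,\boldsymbol y)=f(\tilde{\boldsymbol x})+g(\boldsymbol x)+w_x^\top(\tilde x-x)+w_s^\top(\tilde s-s)+y_I^\top(\tilde z_I-z_I)+y_E^\top(\tilde z_E-z_E).$$ The algorithm FlexQP starts from arbitrary $x^0,s^0,z_I^0,z_E^0,w_s^0,y_I^0,y_E^0$ and for $k=0,1,2,\dots$ performs the following steps. It solves $$(P+\sigma_xI)\tilde x^{k+1}+G^\top\tilde\nu_I^{k+1}+A^\top\tilde\nu_E^{k+1}=\sigma_xx^k-q,$$ $$G\tilde x^{k+1}-(\sigma_s^{-1}+\rho_I^{-1})\tilde\nu_I^{k+1}=h-s^k+\sigma_s^{-1}w_s^k+z_I^k-\rho_I^{-1}y_I^k,$$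 $$A\tilde x^{k+1}-\rho_E^{-1}\tilde\nu_E^{k+1}=b+z_E^k-\rho_E^{-1}y_E^k$$ for $(\tilde x^{k+1},\tilde\nu_I^{k+1},\tilde\nu_E^{k+1})$, and sets $$\tilde s^{k+1}=s^k-\sigma_s^{-1}w_s^k-\sigma_s^{-1}\tilde\nu_I^{k+1},\quad \tilde z_I^{k+1}=z_I^k-\rho_I^{-1}y_I^k+\rho_I^{-1}\tilde\nu_I^{k+1},\quad \tilde z_E^{k+1}=z_E^k-\rho_E^{-1}y_E^k+\rho_E^{-1}\tilde\nu_E^{k+1}.$$ With $\check{\boldsymbol x}^{k+1}=(\check x^{k+1},\check s^{k+1},\check z_I^{k+1},\check z_E^{k+1}):=\alpha\tilde{\boldsymbol x}^{k+1}+(1-\alpha)\boldsymbol x^k$, it then sets $$x^{k+1}=\check x^{k+1},\quad s^{k+1}=(\check s^{k+1}+\sigma_s^{-1}w_s^k)_+,\quad z_I^{k+1}=S_{\mu_I/\rho_I}(\check z_I^{k+1}+\rho_I^{-1}y_I^k),\quad z_E^{k+1}=S_{\mu_E/\rho_E}(\check z_E^{k+1}+\rho_E^{-1}y_E^k),$$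 $$w_s^{k+1}=w_s^k+\sigma_s(\check s^{k+1}-s^{k+1}),\quad y_I^{k+1}=y_I^k+\rho_I(\check z_I^{k+1}-z_I^{k+1}),\quad y_E^{k+1}=y_E^k+\rho_E(\check z_E^{k+1}-z_E^{k+1}),$$ where, coordinatewise, $(v)_+=\max(v,0)$ and $S_\kappa(v)=(v-\kappa)_+-(-v-\kappa)_+$. Put $\boldsymbol y^k=(0,w_s^k,y_I^k,y_E^k)$. Then, for every starting point, the iterates exist and are uniquely determined, and they converge to a saddle point of $\mathcal L$: there is $(\hat{\tilde{\boldsymbol x}},\hat{\boldsymbol x},\hat{\boldsymbol y})$ with $$\mathcal L(\hat{\tilde{\boldsymbol x}},\hat{\boldsymbol x},\boldsymbol y)\le\mathcal L(\hat{\tilde{\boldsymbol x}},\hat{\boldsymbol x},\hat{\boldsymbol y})\le\mathcal L(\tilde{\boldsymbol x},\boldsymbol x,\hat{\boldsymbol y})\quad\text{for all }\tilde{\boldsymbol x},\boldsymbol x,\boldsymbol y,$$ such that $\tilde{\boldsymbol x}^k\to\hat{\tilde{\boldsymbol x}}$, $\boldsymbol x^k\to\hat{\boldsymbol x}$ and $\boldsymbol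 y^k\to\hat{\boldsymbol y}$ as $k\to\infty$. Moreover, the components $(\hat x,\hat s)$ of $\hat{\boldsymbol x}$ minimize $\phi$ over $\{s\ge0\}$, and the residuals $\tilde{\boldsymbol x}^k-\boldsymbol x^k$ and $\boldsymbol x^{k-1}-\boldsymbol x^k$ tend to $0$. -/

import Mathlib

open Filter Topology Matrix

namespace FlexQP

/-- The data of the quadratic program
`min (1/2) xᵀ P x + qᵀ x` subject to `G x ≤ h`, `A x = b`,
with `n` variables, `m` inequality and `p` equality constraints. -/
structure QP (n m p : ℕ) where
  P : Matrix (Fin n) (Fin n) ℝ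
  q : Fin n → ℝ
  G : Matrix (Fin m) (Fin n) ℝ
  h : Fin m → ℝ
  A : Matrix (Fin p) (Fin n) ℝ
  b : Fin p → ℝ

/-- The scalar parameters: elastic penalties `muI, muE`, augmented Lagrangian
penalties `sigmaX, sigmaS, rhoI, rhoE`, and the ADMM relaxation parameter `alpha`. -/
structure Params where
  muI : ℝ
  muE : ℝ
  sigmaX : ℝ
  sigmaS : ℝ
  rhoI : ℝ
  rhoE : ℝ
  alpha : ℝ

/-- Stacked vectors, with the components `(x, s, z_I, z_E)` of a primal block, or
`(w_x, w_s, y_I, y_E)` of the dual variable of the constraint that the two blocks agree. -/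
abbrev Block (n m p : ℕ) : Type :=
  (Fin n → ℝ) × (Fin m → ℝ) × (Fin m → ℝ) × (Fin p → ℝ)

namespace Block

variable {n m p : ℕ}

/-- The component `x` (or `w_x`). -/
def x (v : Block n m p) : Fin n → ℝ := v.1

/-- The component `s` (or `w_s`). -/
def s (v : Block n m p) : Fin m → ℝ := v.2.1

/-- The component `z_I` (or `y_I`). -/
def zI (v : Block n m p) : Fin m → ℝ := v.2.2.1

/-- The component `z_E` (or `y_E`). -/
def zE (v : Block n m p) : Fin p → ℝ := v.2.2.2

end Block

/-- The `ℓ₁` norm of a vector. -/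
def l1 {d : ℕ} (v : Fin d → ℝ) : ℝ := ∑ i, |v i|

/-- The positive part `(v)_+`, taken in every coordinate. -/
def relu {d : ℕ} (v : Fin d → ℝ) : Fin d → ℝ := fun i => max (v i) 0

/-- Soft thresholding `S_κ(v) = (v - κ)_+ - (-v - κ)_+`, taken in every coordinate. -/
def soft {d : ℕ} (κ : ℝ) (v : Fin d → ℝ) : Fin d → ℝ :=
  fun i => max (v i - κ) 0 - max (-v i - κ) 0

section Problem

variable {n m p : ℕ}

/-- The quadratic objective `(1/2) xᵀ P x + qᵀ x`. -/
noncomputable def quad (Q : QP n m p) (x : Fin n → ℝ) : ℝ :=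
  (1 / 2) * (x ⬝ᵥ (Q.P *ᵥ x)) + Q.q ⬝ᵥ x

/-- The relaxed objective `φ(x, s; μ_I, μ_E)`. -/
noncomputable def phi (Q : QP n m p) (muI muE : ℝ) (x : Fin n → ℝ) (s : Fin m → ℝ) : ℝ :=
  quad Q x + muI * l1 (Q.G *ᵥ x + s - Q.h) + muE * l1 (Q.A *ᵥ x - Q.b)

open Classical in
/-- The indicator function of a condition: `0` if it holds and `+∞` otherwise. -/
noncomputable def ind (c : Prop) : EReal := if c then 0 else ⊤

/-- The first part `f` of the split objective, with values in `ℝ ∪ {+∞}`. -/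
noncomputable def f (Q : QP n m p) (v : Block n m p) : EReal :=
  (quad Q v.x : EReal) + ind (v.zI = Q.G *ᵥ v.x + v.s - Q.h) + ind (v.zE = Q.A *ᵥ v.x - Q.b)

/-- The second part `g` of the split objective, with values in `ℝ ∪ {+∞}`. -/
noncomputable def g (muI muE : ℝ) (v : Block n m p) : EReal :=
  ind (0 ≤ v.s) + ((muI * l1 v.zI + muE * l1 v.zE : ℝ) : EReal)

/-- The Lagrangian `L(xt, x, y)` of `min f(xt) + g(x)` subject to `xt = x`. -/
noncomputable def lagrangian (Q : QP n m p) (muI muE : ℝ) (xt x y : Block n m p) : EReal :=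
  f Q xt + g muI muE x +
    ((y.x ⬝ᵥ (xt.x - x.x) + y.s ⬝ᵥ (xt.s - x.s)
      + y.zI ⬝ᵥ (xt.zI - x.zI) + y.zE ⬝ᵥ (xt.zE - x.zE) : ℝ) : EReal)

/-- `(xt, x, y)` is a saddle point of the Lagrangian: it minimizes over the primal
variables `(xt, x)` and maximizes over the dual variable `y`. -/
def IsSaddle (Q : QP n m p) (muI muE : ℝ) (xt x y : Block n m p) : Prop :=
  (∀ y' : Block n m p, lagrangian Q muI muE xt x y' ≤ lagrangian Q muI muE xt x y) ∧
  (∀ xt' x' : Block n m p, lagrangian Q muI muE xt x y ≤ lagrangian Q muI muE xt' x' y)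

end Problem

/-- The variables that the algorithm carries from one iteration to the next. -/
structure State (n m p : ℕ) where
  x : Fin n → ℝ
  s : Fin m → ℝ
  zI : Fin m → ℝ
  zE : Fin p → ℝ
  ws : Fin m → ℝ
  yI : Fin m → ℝ
  yE : Fin p → ℝ

/-- The primal block `(x, s, z_I, z_E)` of a state. -/
def State.primal {n m p : ℕ} (u : State n m p) : Block n m p := (u.x, u.s, u.zI, u.zE)

/-- The dual variable `(w_x, w_s, y_I, y_E)` of a state; the algorithm has `w_x = 0`. -/
def State.dual {n m p : ℕ} (u : State n m p) : Block n m p := (0, u.ws, u.yI, u.yE)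

/-- The linear system of the first block update, in the unknowns `(xt, nuI, nuE)`:
`(P + σ_x I) xt + Gᵀ nuI + Aᵀ nuE = σ_x x - q`,
`G xt - (σ_s⁻¹ + ρ_I⁻¹) nuI = h - s + σ_s⁻¹ w_s + z_I - ρ_I⁻¹ y_I`,
`A xt - ρ_E⁻¹ nuE = b + z_E - ρ_E⁻¹ y_E`. -/
structure SolvesSystem {n m p : ℕ} (Q : QP n m p) (θ : Params) (u : State n m p)
    (xt : Fin n → ℝ) (nuI : Fin m → ℝ) (nuE : Fin p → ℝ) : Prop where
  row_x : (Q.P + θ.sigmaX • (1 : Matrix (Fin n) (Fin n) ℝ)) *ᵥ xt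
      + Q.Gᵀ *ᵥ nuI + Q.Aᵀ *ᵥ nuE = θ.sigmaX • u.x - Q.q
  row_I : Q.G *ᵥ xt - (θ.sigmaS⁻¹ + θ.rhoI⁻¹) • nuI
      = Q.h - u.s + θ.sigmaS⁻¹ • u.ws + u.zI - θ.rhoI⁻¹ • u.yI
  row_E : Q.A *ᵥ xt - θ.rhoE⁻¹ • nuE = Q.b + u.zE - θ.rhoE⁻¹ • u.yE

/-- One iteration of the algorithm: from the state `u`, the solution `(t.x, nuI, nuE)` of
the linear system, the first block `t`, and the next state `v`. The over-relaxed point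
`α t + (1 - α) u` takes the place of `t` in the second block update and in the dual update. -/
structure IsStep {n m p : ℕ} (Q : QP n m p) (θ : Params) (u : State n m p)
    (nuI : Fin m → ℝ) (nuE : Fin p → ℝ) (t : Block n m p) (v : State n m p) : Prop where
  system : SolvesSystem Q θ u t.x nuI nuE
  tilde_s : t.s = u.s - θ.sigmaS⁻¹ • u.ws - θ.sigmaS⁻¹ • nuI
  tilde_zI : t.zI = u.zI - θ.rhoI⁻¹ • u.yI + θ.rhoI⁻¹ • nuI
  tilde_zE : t.zE = u.zE - θ.rhoE⁻¹ • u.yE + θ.rhoE⁻¹ • nuE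
  next_x : v.x = θ.alpha • t.x + (1 - θ.alpha) • u.x
  next_s : v.s = relu (θ.alpha • t.s + (1 - θ.alpha) • u.s + θ.sigmaS⁻¹ • u.ws)
  next_zI : v.zI = soft (θ.muI / θ.rhoI)
      (θ.alpha • t.zI + (1 - θ.alpha) • u.zI + θ.rhoI⁻¹ • u.yI)
  next_zE : v.zE = soft (θ.muE / θ.rhoE)
      (θ.alpha • t.zE + (1 - θ.alpha) • u.zE + θ.rhoE⁻¹ • u.yE)
  next_ws : v.ws = u.ws + θ.sigmaS • (θ.alpha • t.s + (1 - θ.alpha) • u.s - v.s)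
  next_yI : v.yI = u.yI + θ.rhoI • (θ.alpha • t.zI + (1 - θ.alpha) • u.zI - v.zI)
  next_yE : v.yE = u.yE + θ.rhoE • (θ.alpha • t.zE + (1 - θ.alpha) • u.zE - v.zE)

/-- The sequences produced by the algorithm: `state k` is the state after `k` iterations,
and `nuI k`, `nuE k`, `tilde k` are computed in iteration `k + 1`, so that `tilde k` is
the first block with superscript `k + 1`. -/
structure Run (n m p : ℕ) where
  state : ℕ → State n m p
  nuI : ℕ → Fin m → ℝ
  nuE : ℕ → Fin p → ℝ
  tilde : ℕ → Block n m p

/-- `r` is the infinite run of the algorithm that starts in the state `u`. -/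
def IsRunFrom {n m p : ℕ} (Q : QP n m p) (θ : Params) (u : State n m p)
    (r : Run n m p) : Prop :=
  r.state 0 = u ∧
    ∀ k, IsStep Q θ (r.state k) (r.nuI k) (r.nuE k) (r.tilde k) (r.state (k + 1))

end FlexQP

/-! The algorithm is relaxed Douglas–Rachford splitting for the monotone operators `∂f` and `∂g`, in
the inner product weighted by the penalties. Let `x` be the primal block of a state produced by a
step, `w` its dual variable divided by the weights, and `t` the first block computed from it. Then
`w` is a subgradient of `g` at `x` (`IsStep.subG`), `x - t - w` is a subgradient of `f` at `t`
(`IsStep.subF`), and `x + w` moves by `α (t - x)` (`IsStep.add_scaledDual`).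

Monotonicity makes the squared distance from `x + w` to `a + b` drop by at least `α (2 - α) ‖t -
x‖²`, for every solution pair `(a, b)`. Hence `t - x` tends to 0. Cluster points are solutions
because both graphs are closed, and monotonicity of the distance to one cluster point forces
convergence (`tendsto_douglasRachford`). A limit with `y` in `∂g` and `-y` in `∂f` is a saddle point
by adding two subgradient inequalities.

All this needs one primal-dual solution, which must come from boundedness below alone. After
eliminating `s`, the objective is a convex quadratic plus a support function of a box. `exists_kkt`
adds a vanishing Tikhonov term, solves each regularized problem through its compact dual, and passes
to the limit. If the regularized solutions were unbounded, their limit direction `d` would satisfy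
`P d = 0` and turn out orthogonal to itself. -/

namespace FlexQP

/-! ### Box complementarity and algebraic preliminaries -/

/-- Complementarity of a multiplier `w` in the box `[lo, hi]` and a residual `r`: `w` maximizes
`w ⬝ᵥ r` over the box. -/
def Compl {ι : Type*} (lo hi w r : ι → ℝ) : Prop :=
  w ∈ Set.Icc lo hi ∧ ∀ i, 0 ≤ (w i - lo i) * r i ∧ 0 ≤ (w i - hi i) * r i

theorem Compl.eq_hi {ι : Type*} {lo hi w r : ι → ℝ} (h : Compl lo hi w r) {i : ι}
    (hr : 0 < r i) : w i = hi i := by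
  have h1 := nonneg_of_mul_nonneg_left (h.2 i).2 hr
  have h2 := h.1.2 i
  linarith

theorem Compl.eq_lo {ι : Type*} {lo hi w r : ι → ℝ} (h : Compl lo hi w r) {i : ι}
    (hr : r i < 0) : w i = lo i := by
  have h1 := nonpos_of_mul_nonneg_left (h.2 i).1 hr
  have h2 := h.1.1 i
  linarith

theorem isClosed_compl {ι : Type*} (lo hi : ι → ℝ) :
    IsClosed {v : (ι → ℝ) × (ι → ℝ) | Compl lo hi v.1 v.2} := by
  unfold Compl
  simp only [Set.ofPred_and, Set.ofPred_forall]
  refine (isClosed_Icc.preimage continuous_fst).inter (isClosed_iInter fun i => ?_)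
  exact (isClosed_le (by fun_prop) (by fun_prop)).inter (isClosed_le (by fun_prop) (by fun_prop))

/-- First-order optimality along a segment. If `L < 0`, the step `-L / (|S| - L + 1)` is at most 1
and so small that the linear term dominates. -/
theorem nonneg_of_quadratic {L S : ℝ} (h : ∀ τ : ℝ, 0 < τ → τ ≤ 1 → 0 ≤ τ * L + τ ^ 2 * S) :
    0 ≤ L := by
  by_contra! hL
  have hD : 0 < |S| - L + 1 := by linarith [abs_nonneg S]
  have hτ : 0 < -L / (|S| - L + 1) := div_pos (by linarith) hD
  have h1 := h _ hτ (by rw [div_le_one hD]; linarith [abs_nonneg S])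
  set τ := -L / (|S| - L + 1) with hdef
  have h2 : τ * (|S| - L + 1) = -L := by rw [hdef]; field_simp
  have h3 : 0 ≤ L + τ * S := by
    have : 0 ≤ τ * (L + τ * S) := by linarith
    exact nonneg_of_mul_nonneg_right this hτ
  have h4 : τ * S ≤ τ * |S| := mul_le_mul_of_nonneg_left (le_abs_self S) hτ.le
  nlinarith

theorem mulVec_dotProduct_comm {n : ℕ} {P : Matrix (Fin n) (Fin n) ℝ} (hP : Pᵀ = P)
    (x y : Fin n → ℝ) : (P *ᵥ x) ⬝ᵥ y = x ⬝ᵥ (P *ᵥ y) := by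
  rw [dotProduct_mulVec, ← mulVec_transpose, hP]

theorem transpose_mulVec_dotProduct {ι κ : Type*} [Fintype ι] [Fintype κ] (K : Matrix ι κ ℝ)
    (w : ι → ℝ) (x : κ → ℝ) : (Kᵀ *ᵥ w) ⬝ᵥ x = w ⬝ᵥ (K *ᵥ x) := by
  rw [dotProduct_mulVec, mulVec_transpose]

/-! ### Existence of KKT points -/

section KKT

variable {ι : Type*} [Fintype ι] {n : ℕ}

/-- A strictly convex quadratic plus a piecewise linear term has a KKT point, obtained by
minimizing the dual over the box of multipliers. -/
theorem exists_kkt_of_posDef {M : Matrix (Fin n) (Fin n) ℝ} (hM : M.PosDef) (q : Fin n → ℝ)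
    (K : Matrix ι (Fin n) ℝ) (c lo hi : ι → ℝ) (hlh : lo ≤ hi) :
    ∃ x w, Compl lo hi w (K *ᵥ x - c) ∧ M *ᵥ x + q + Kᵀ *ᵥ w = 0 := by
  classical
  have hMN : M * M⁻¹ = 1 := mul_nonsing_inv _ ((isUnit_iff_isUnit_det _).1 hM.isUnit)
  have hN : (M⁻¹)ᵀ = M⁻¹ := by
    rw [← conjTranspose_eq_transpose_of_trivial, hM.inv.isHermitian.eq]
  obtain ⟨w, hw, hmin⟩ := (isCompact_Icc : IsCompact (Set.Icc lo hi)).exists_isMinOn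
    (Set.nonempty_Icc.2 hlh) (f := fun w => (1 / 2) * ((q + Kᵀ *ᵥ w) ⬝ᵥ (M⁻¹ *ᵥ (q + Kᵀ *ᵥ w)))
      + c ⬝ᵥ w) (by fun_prop)
  refine ⟨-(M⁻¹ *ᵥ (q + Kᵀ *ᵥ w)), w, ⟨hw, ?_⟩, ?_⟩
  swap
  · rw [mulVec_neg, mulVec_mulVec, hMN, one_mulVec]; abel
  set a := q + Kᵀ *ᵥ w with ha
  -- The dual objective has partial derivative `-(K x - c) i` at `w`, with `x = -M⁻¹ a`. Minimality
  -- makes it nonnegative along every coordinate move that stays in the box.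
  have key : ∀ i (e : ℝ), lo i ≤ w i + e → w i + e ≤ hi i →
      0 ≤ -(e * (K *ᵥ (-(M⁻¹ *ᵥ a)) - c) i) := by
    intro i e h1 h2
    set d : ι → ℝ := Pi.single i e with hd
    have hexp : ∀ τ : ℝ, 0 < τ → τ ≤ 1 →
        0 ≤ τ * (-(e * (K *ᵥ (-(M⁻¹ *ᵥ a)) - c) i))
          + τ ^ 2 * ((1 / 2) * ((Kᵀ *ᵥ d) ⬝ᵥ (M⁻¹ *ᵥ (Kᵀ *ᵥ d)))) := by
      intro τ h0 h3
      have hmem : w + τ • d ∈ Set.Icc lo hi := by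
        constructor <;> intro j <;> by_cases hj : j = i
        · subst hj
          have := hw.1 j
          simp [hd]; nlinarith
        · have := hw.1 j
          simpa [hd, hj] using this
        · subst hj
          have := hw.2 j
          simp [hd]; nlinarith
        · have := hw.2 j
          simpa [hd, hj] using this
      have hle := hmin hmem
      simp only [Set.mem_ofPred_eq] at hle
      have ha' : q + Kᵀ *ᵥ (w + τ • d) = a + τ • (Kᵀ *ᵥ d) := by
        rw [mulVec_add, mulVec_smul, ha]; abel
      have hs : a ⬝ᵥ (M⁻¹ *ᵥ (Kᵀ *ᵥ d)) = (Kᵀ *ᵥ d) ⬝ᵥ (M⁻¹ *ᵥ a) := by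
        rw [← mulVec_dotProduct_comm hN, dotProduct_comm]
      have hk : (Kᵀ *ᵥ d) ⬝ᵥ (M⁻¹ *ᵥ a) = e * (K *ᵥ (M⁻¹ *ᵥ a)) i := by
        rw [transpose_mulVec_dotProduct, hd, single_dotProduct]
      have hc : c ⬝ᵥ d = e * c i := by rw [hd, dotProduct_single, mul_comm]
      rw [ha', ← ha] at hle
      simp only [mulVec_add, mulVec_smul, dotProduct_add, add_dotProduct, smul_dotProduct,
        dotProduct_smul, smul_eq_mul, hs, hk, hc] at hle
      rw [mulVec_neg]
      simp only [Pi.sub_apply, Pi.neg_apply]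
      linarith
    exact nonneg_of_quadratic hexp
  intro i
  -- Moving coordinate `i` all the way to either end of the box gives the two complementarity
  -- inequalities.
  have h1 := key i (lo i - w i) (by linarith) (by linarith [hlh i])
  have h2 := key i (hi i - w i) (by linarith [hlh i]) (by linarith)
  constructor <;> linarith

/-- A convex quadratic plus a piecewise linear term that is bounded below has a KKT point. -/
theorem exists_kkt {P : Matrix (Fin n) (Fin n) ℝ} (hP : P.PosSemidef) (q : Fin n → ℝ)
    (K : Matrix ι (Fin n) ℝ) (c lo hi : ι → ℝ) (hlh : lo ≤ hi) (B : ℝ)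
    (hB : ∀ x w, Compl lo hi w (K *ᵥ x - c) →
      B ≤ (1 / 2) * (x ⬝ᵥ (P *ᵥ x)) + q ⬝ᵥ x + w ⬝ᵥ (K *ᵥ x - c)) :
    ∃ x w, Compl lo hi w (K *ᵥ x - c) ∧ P *ᵥ x + q + Kᵀ *ᵥ w = 0 := by
  classical
  have hPt : Pᵀ = P := by
    rw [← conjTranspose_eq_transpose_of_trivial, hP.isHermitian.eq]
  have hreg : ∀ k : ℕ, ∃ x w, Compl lo hi w (K *ᵥ x - c) ∧
      P *ᵥ x + (1 / ((k : ℝ) + 1)) • x + q + Kᵀ *ᵥ w = 0 := by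
    intro k
    have hM : (P + (1 / ((k : ℝ) + 1)) • (1 : Matrix (Fin n) (Fin n) ℝ)).PosDef :=
      PosDef.posSemidef_add hP (PosDef.one.smul (by positivity))
    obtain ⟨x, w, h1, h2⟩ := exists_kkt_of_posDef hM q K c lo hi hlh
    refine ⟨x, w, h1, ?_⟩
    rwa [add_mulVec, smul_mulVec, one_mulVec] at h2
  choose x w hcomp heq using hreg
  obtain ⟨C, hC⟩ := (isCompact_Icc : IsCompact (Set.Icc lo hi)).exists_bound_of_continuousOn
    (f := fun w => w ⬝ᵥ c) (by fun_prop)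
  -- Pair the stationarity equation with `x k` and compare with the lower bound `B`; the leftover
  -- term `w ⬝ᵥ c` is bounded on the box.
  have hbound : ∀ k : ℕ, (1 / ((k : ℝ) + 1)) * (x k ⬝ᵥ x k) ≤ C - B := by
    intro k
    have h1 := hB _ _ (hcomp k)
    have h2 := congrArg (fun v => v ⬝ᵥ x k) (heq k)
    simp only [add_dotProduct, smul_dotProduct, zero_dotProduct, smul_eq_mul,
      transpose_mulVec_dotProduct] at h2
    rw [dotProduct_sub] at h1
    rw [dotProduct_comm (P *ᵥ x k)] at h2
    have h3 := hC _ (hcomp k).1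
    rw [Real.norm_eq_abs, abs_le] at h3
    have h4 : 0 ≤ x k ⬝ᵥ (P *ᵥ x k) := by simpa using hP.dotProduct_mulVec_nonneg (x k)
    linarith [h3.1]
  have hsmall : Tendsto (fun k : ℕ => (1 / ((k : ℝ) + 1)) • x k) atTop (𝓝 0) := by
    rw [tendsto_pi_nhds]
    intro i
    have hlim : Tendsto (fun k : ℕ => √((1 / ((k : ℝ) + 1)) * (C - B))) atTop (𝓝 0) := by
      have := (tendsto_one_div_add_atTop_nhds_zero_nat (𝕜 := ℝ)).mul_const (C - B)
      simpa using this.sqrt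
    refine squeeze_zero_norm (fun k => ?_) hlim
    rw [Real.norm_eq_abs]
    apply Real.abs_le_sqrt
    have h1 : x k i * x k i ≤ x k ⬝ᵥ x k :=
      Finset.single_le_sum (f := fun i => x k i * x k i) (fun j _ => mul_self_nonneg _)
        (Finset.mem_univ i)
    have h2 : 0 < 1 / ((k : ℝ) + 1) := by positivity
    simp only [Pi.smul_apply, smul_eq_mul]
    nlinarith [hbound k, mul_le_mul_of_nonneg_left h1 h2.le]
  -- There are finitely many sign patterns of the residual, so one of them recurs infinitely often.
  have hsign : ∃ σ : ι → SignType, ∃ᶠ k in atTop, ∀ i, SignType.sign ((K *ᵥ x k - c) i) = σ i := by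
    rw [← frequently_exists]
    exact Frequently.of_forall fun k => ⟨_, fun i => rfl⟩
  obtain ⟨σ, hσ⟩ := hsign
  obtain ⟨φ, hφ, hσφ⟩ := extraction_of_frequently_atTop hσ
  by_cases hbd : ∃ R, ∃ᶠ k in atTop, x (φ k) ∈ Metric.closedBall (0 : Fin n → ℝ) R
  · obtain ⟨R, hR⟩ := hbd
    obtain ⟨a, -, ψ, hψ, ha⟩ :=
      tendsto_subseq_of_frequently_bounded Metric.isBounded_closedBall hR
    obtain ⟨b, -, χ, hχ, hb⟩ :=
      (isCompact_Icc : IsCompact (Set.Icc lo hi)).tendsto_subseq (x := fun k => w (φ (ψ k)))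
        fun k => (hcomp _).1
    have ha' : Tendsto (fun k => x (φ (ψ (χ k)))) atTop (𝓝 a) := ha.comp hχ.tendsto_atTop
    have hs' : Tendsto (fun k => (1 / ((φ (ψ (χ k)) : ℝ) + 1)) • x (φ (ψ (χ k)))) atTop (𝓝 0) :=
      hsmall.comp (hφ.tendsto_atTop.comp (hψ.tendsto_atTop.comp hχ.tendsto_atTop))
    have hb' : Tendsto (fun k => w (φ (ψ (χ k)))) atTop (𝓝 b) := hb
    refine ⟨a, b, ?_, ?_⟩
    · have hr : Tendsto (fun k => K *ᵥ x (φ (ψ (χ k))) - c) atTop (𝓝 (K *ᵥ a - c)) :=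
        ((by fun_prop : Continuous fun v => K *ᵥ v - c).tendsto a).comp ha'
      exact (isClosed_compl lo hi).mem_of_tendsto (hb'.prodMk_nhds hr)
        (Eventually.of_forall fun k => hcomp _)
    · have hPx := ((by fun_prop : Continuous fun v => P *ᵥ v).tendsto a).comp ha'
      have hKw := ((by fun_prop : Continuous fun v => Kᵀ *ᵥ v).tendsto b).comp hb'
      have hall := ((hPx.add hs').add_const q).add hKw
      rw [add_zero] at hall
      refine tendsto_nhds_unique hall ?_
      refine tendsto_const_nhds.congr fun k => ?_
      exact (heq _).symm
  -- Unbounded case: normalize and extract a limit direction `d` of norm 1.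
  · exfalso
    push Not at hbd
    have hinf : Tendsto (fun k => ‖x (φ k)‖) atTop atTop := by
      rw [tendsto_atTop]
      intro R
      filter_upwards [hbd R] with k hk
      rw [mem_closedBall_zero_iff, not_le] at hk
      exact hk.le
    obtain ⟨d, -, ψ, hψ, hd⟩ := (isCompact_closedBall (0 : Fin n → ℝ) 1).tendsto_subseq
      (x := fun k => ‖x (φ k)‖⁻¹ • x (φ k)) (by
        intro k
        rw [mem_closedBall_zero_iff, norm_smul, norm_inv, norm_norm]
        exact inv_mul_le_one)
    obtain ⟨b, -, χ, hχ, hb⟩ :=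
      (isCompact_Icc : IsCompact (Set.Icc lo hi)).tendsto_subseq (x := fun k => w (φ (ψ k)))
        fun k => (hcomp _).1
    set N : ℕ → ℕ := fun k => φ (ψ (χ k)) with hNdef
    have hNsub : Tendsto (fun k => ψ (χ k)) atTop atTop :=
      hψ.tendsto_atTop.comp hχ.tendsto_atTop
    have hN : Tendsto N atTop atTop := hφ.tendsto_atTop.comp hNsub
    have hinfN : Tendsto (fun k => ‖x (N k)‖) atTop atTop := hinf.comp hNsub
    have hinv : Tendsto (fun k => ‖x (N k)‖⁻¹) atTop (𝓝 0) := tendsto_inv_atTop_zero.comp hinfN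
    have hu : Tendsto (fun k => ‖x (N k)‖⁻¹ • x (N k)) atTop (𝓝 d) := hd.comp hχ.tendsto_atTop
    have hwb : Tendsto (fun k => w (N k)) atTop (𝓝 b) := hb
    have hsN : Tendsto (fun k => (1 / ((N k : ℝ) + 1)) • x (N k)) atTop (𝓝 0) := hsmall.comp hN
    have hdnorm : ‖d‖ = 1 := by
      refine tendsto_nhds_unique hu.norm ?_
      refine tendsto_const_nhds.congr' ?_
      filter_upwards [hinfN.eventually_gt_atTop 0] with k hk
      rw [norm_smul, norm_inv, norm_norm, inv_mul_cancel₀ hk.ne']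
    -- Divide stationarity by `‖x (N k)‖`: every term except `P x` is bounded.
    have hPd : P *ᵥ d = 0 := by
      have h1 : Tendsto (fun k => P *ᵥ (‖x (N k)‖⁻¹ • x (N k))) atTop (𝓝 (P *ᵥ d)) :=
        ((by fun_prop : Continuous fun v => P *ᵥ v).tendsto d).comp hu
      have hKw := ((by fun_prop : Continuous fun v => Kᵀ *ᵥ v).tendsto b).comp hwb
      have h2 := hinv.smul (((hsN.add_const q).add hKw).neg)
      rw [zero_smul] at h2
      refine tendsto_nhds_unique h1 (h2.congr fun k => ?_)
      rw [mulVec_smul]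
      congr 1
      have := heq (N k)
      rw [add_assoc, add_assoc, ← add_assoc _ q] at this
      exact (eq_neg_of_add_eq_zero_left this).symm
    -- A residual of fixed nonzero sign pins `w i` to an endpoint of the box. A residual that is
    -- always zero fixes `(K x) i = c i`, so `(K d) i = 0` after normalization.
    have hpat : ∀ k, w (N k) ⬝ᵥ (K *ᵥ d) = w (N 0) ⬝ᵥ (K *ᵥ d) := by
      intro k
      refine Finset.sum_congr rfl fun i _ => ?_
      have hk := hσφ (ψ (χ k)) i
      have h0 := hσφ (ψ (χ 0)) i
      rcases lt_trichotomy ((K *ᵥ x (N k) - c) i) 0 with h | h | h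
      · have h' : (K *ᵥ x (N 0) - c) i < 0 := by
          rw [← sign_eq_neg_one_iff] at h ⊢
          exact h0.trans (hk.symm.trans h)
        rw [(hcomp (N k)).eq_lo h, (hcomp (N 0)).eq_lo h']
      · have hz : ∀ j, (K *ᵥ x (N j)) i = c i := by
          intro j
          have hj := hσφ (ψ (χ j)) i
          have : (K *ᵥ x (N j) - c) i = 0 := by
            rw [← sign_eq_zero_iff] at h ⊢
            exact hj.trans (hk.symm.trans h)
          simpa [sub_eq_zero] using this
        have hKd : (K *ᵥ d) i = 0 := by
          have h1 : Tendsto (fun k => (K *ᵥ (‖x (N k)‖⁻¹ • x (N k))) i) atTop (𝓝 ((K *ᵥ d) i)) :=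
            ((by fun_prop : Continuous fun v => (K *ᵥ v) i).tendsto d).comp hu
          have h2 := hinv.mul_const (c i)
          rw [zero_mul] at h2
          refine tendsto_nhds_unique h1 (h2.congr fun k => ?_)
          rw [mulVec_smul, Pi.smul_apply, hz, smul_eq_mul]
        rw [hKd, mul_zero, mul_zero]
      · have h' : 0 < (K *ᵥ x (N 0) - c) i := by
          rw [← sign_eq_one_iff] at h ⊢
          exact h0.trans (hk.symm.trans h)
        rw [(hcomp (N k)).eq_hi h, (hcomp (N 0)).eq_hi h']
    -- Pairing stationarity with `d` removes `P`, so the regularization term has a constant product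
    -- with `d`. That term tends to 0, hence the constant is 0 and every `x (N k)` is orthogonal to
    -- `d`.
    have hconst : ∀ k, ((1 / ((N k : ℝ) + 1)) • x (N k)) ⬝ᵥ d
        = -(q ⬝ᵥ d + w (N 0) ⬝ᵥ (K *ᵥ d)) := by
      intro k
      have h2 := congrArg (fun v => v ⬝ᵥ d) (heq (N k))
      simp only [add_dotProduct, zero_dotProduct, transpose_mulVec_dotProduct,
        mulVec_dotProduct_comm hPt, hPd, dotProduct_zero, hpat k] at h2
      linarith
    have hzero : -(q ⬝ᵥ d + w (N 0) ⬝ᵥ (K *ᵥ d)) = 0 := by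
      have h1 := ((by fun_prop : Continuous fun v : Fin n → ℝ => v ⬝ᵥ d).tendsto 0).comp hsN
      rw [zero_dotProduct] at h1
      refine tendsto_nhds_unique ?_ h1
      exact tendsto_const_nhds.congr fun k => (hconst k).symm
    have horth : ∀ k, x (N k) ⬝ᵥ d = 0 := by
      intro k
      have h1 := (hconst k).trans hzero
      rw [smul_dotProduct, smul_eq_mul] at h1
      have h2 : 0 < 1 / ((N k : ℝ) + 1) := by positivity
      exact (mul_eq_zero.1 h1).resolve_left h2.ne'
    have hdd : d ⬝ᵥ d = 0 := by
      have h1 := ((by fun_prop : Continuous fun v : Fin n → ℝ => v ⬝ᵥ d).tendsto d).comp hu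
      refine tendsto_nhds_unique h1 (tendsto_const_nhds.congr fun k => ?_)
      simp [horth]
    rw [dotProduct_self_eq_zero] at hdd
    simp [hdd] at hdnorm

end KKT

/-! ### Convergence of relaxed Douglas–Rachford splitting -/

section DouglasRachford

variable {V : Type*} [NormedAddCommGroup V] [NormedSpace ℝ V] [FiniteDimensional ℝ V]

/-- Compactness of the unit sphere. The norm of `V` need not come from `B`; stacked vectors carry
the sup norm. -/
theorem exists_coercive (B : V →ₗ[ℝ] V →ₗ[ℝ] ℝ) (hcont : Continuous fun v => B v v)
    (hpos : ∀ v, v ≠ 0 → 0 < B v v) : ∃ c > 0, ∀ v, c * ‖v‖ ^ 2 ≤ B v v := by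
  have : ProperSpace V := FiniteDimensional.proper_real V
  -- The sphere is empty exactly when `V` is trivial.
  rcases (Metric.sphere (0 : V) 1).eq_empty_or_nonempty with he | hne
  · refine ⟨1, one_pos, fun v => ?_⟩
    by_cases hv : v = 0
    · simp [hv]
    · exfalso
      have : ‖v‖⁻¹ • v ∈ Metric.sphere (0 : V) 1 := by
        rw [mem_sphere_zero_iff_norm, norm_smul, norm_inv, norm_norm,
          inv_mul_cancel₀ (norm_ne_zero_iff.2 hv)]
      simp [he] at this
  · obtain ⟨a, ha, hmin⟩ := (isCompact_sphere (0 : V) 1).exists_isMinOn hne hcont.continuousOn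
    rw [mem_sphere_zero_iff_norm] at ha
    refine ⟨B a a, hpos a (by rintro rfl; simp at ha), fun v => ?_⟩
    by_cases hv : v = 0
    · simp [hv]
    have hn : 0 < ‖v‖ := norm_pos_iff.2 hv
    have h1 : ‖v‖⁻¹ • v ∈ Metric.sphere (0 : V) 1 := by
      rw [mem_sphere_zero_iff_norm, norm_smul, norm_inv, norm_norm, inv_mul_cancel₀ hn.ne']
    have h2 := hmin h1
    simp only [Set.mem_ofPred_eq, map_smul, LinearMap.smul_apply, smul_eq_mul] at h2
    calc B a a * ‖v‖ ^ 2 ≤ (‖v‖⁻¹ * (‖v‖⁻¹ * B v v)) * ‖v‖ ^ 2 := by gcongr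
      _ = B v v := by field_simp

/-- Convergence of the relaxed Douglas–Rachford splitting for two closed relations that are
monotone for a positive definite form `B`. Here `F` plays the role of `∂f` and `G` of `∂g`. -/
theorem tendsto_douglasRachford (B : V →ₗ[ℝ] V →ₗ[ℝ] ℝ) (hsymm : ∀ u v, B u v = B v u)
    (hcont : Continuous fun v => B v v) (hpos : ∀ v, v ≠ 0 → 0 < B v v)
    {F G : Set (V × V)} (hFc : IsClosed F) (hGc : IsClosed G)
    (hF : ∀ a ∈ F, ∀ b ∈ F, 0 ≤ B (a.1 - b.1) (a.2 - b.2))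
    (hG : ∀ a ∈ G, ∀ b ∈ G, 0 ≤ B (a.1 - b.1) (a.2 - b.2))
    {α : ℝ} (hα0 : 0 < α) (hα2 : α < 2) {x w t : ℕ → V}
    (hxw : ∀ k, (x k, w k) ∈ G) (ht : ∀ k, (t k, x k - t k - w k) ∈ F)
    (hstep : ∀ k, x (k + 1) + w (k + 1) = x k + w k + α • (t k - x k))
    (hsol : ∃ x₀ w₀, (x₀, w₀) ∈ G ∧ (x₀, -w₀) ∈ F) :
    ∃ a b, (a, b) ∈ G ∧ (a, -b) ∈ F ∧ Tendsto x atTop (𝓝 a) ∧ Tendsto w atTop (𝓝 b) ∧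
      Tendsto t atTop (𝓝 a) := by
  have : ProperSpace V := FiniteDimensional.proper_real V
  obtain ⟨c, hc, hcoer⟩ := exists_coercive B hcont hpos
  have hnn : ∀ v, 0 ≤ B v v := fun v => le_trans (by positivity) (hcoer v)
  -- With `d = t - x`, `p = x - a`, `r = w - b`, monotonicity of `G` and `F` gives `B p r ≥ 0` and
  -- `B (d + p) (d + r) ≤ 0`, so `B (p + r) d ≤ -B d d`. Expanding the square of `p + r + α d` then
  -- yields the decrease.
  have fejer : ∀ a b, (a, b) ∈ G → (a, -b) ∈ F → ∀ k,
      B (x (k + 1) - a + (w (k + 1) - b)) (x (k + 1) - a + (w (k + 1) - b))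
        + α * (2 - α) * B (t k - x k) (t k - x k)
      ≤ B (x k - a + (w k - b)) (x k - a + (w k - b)) := by
    intro a b hab hab' k
    have h1 := hG _ (hxw k) _ hab
    have h2 := hF _ (ht k) _ hab'
    have e : x (k + 1) - a + (w (k + 1) - b) = x k - a + (w k - b) + α • (t k - x k) := by
      calc _ = x (k + 1) + w (k + 1) - (a + b) := by abel
        _ = _ := by rw [hstep k]; abel
    rw [e]
    simp only at h1 h2
    have e2 : x k - t k - w k - -b = -((t k - x k) + (w k - b)) := by abel
    have e1 : t k - a = (t k - x k) + (x k - a) := by abel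
    rw [e2, e1] at h2
    generalize t k - x k = d at *
    generalize x k - a = p at *
    generalize w k - b = r at *
    simp only [map_add, map_neg, map_smul, LinearMap.add_apply, LinearMap.smul_apply,
      smul_eq_mul] at *
    rw [hsymm r p, hsymm p d, hsymm r d] at *
    nlinarith
  have hmono : ∀ a b, (a, b) ∈ G → (a, -b) ∈ F →
      Antitone fun k => B (x k - a + (w k - b)) (x k - a + (w k - b)) := by
    intro a b hab hab'
    refine antitone_nat_of_succ_le fun k => ?_
    have := mul_nonneg (mul_nonneg hα0.le (sub_nonneg.2 hα2.le)) (hnn (t k - x k))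
    linarith [fejer a b hab hab' k]
  -- The cross term is nonnegative by monotonicity of `G`, so control of the sum `x + w` controls
  -- `x` and `w` separately.
  have hsplit : ∀ a b, (a, b) ∈ G → ∀ k, c * ‖x k - a‖ ^ 2 + c * ‖w k - b‖ ^ 2
      ≤ B (x k - a + (w k - b)) (x k - a + (w k - b)) := by
    intro a b hab k
    have h1 := hG _ (hxw k) _ hab
    have h2 := hcoer (x k - a)
    have h3 := hcoer (w k - b)
    simp only at h1
    simp only [map_add, LinearMap.add_apply]
    rw [hsymm (w k - b) (x k - a)]
    linarith
  have htend : ∀ (z : ℕ → V) (V' : ℕ → ℝ), (∀ k, c * ‖z k‖ ^ 2 ≤ V' k) →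
      Tendsto V' atTop (𝓝 0) → Tendsto z atTop (𝓝 0) := by
    intro z V' hz hV
    have h1 : Tendsto (fun k => √(V' k / c)) atTop (𝓝 0) := by
      simpa using (hV.div_const c).sqrt
    refine squeeze_zero_norm (fun k => ?_) h1
    apply Real.le_sqrt_of_sq_le
    rw [le_div_iff₀ hc]
    linarith [hz k]
  obtain ⟨x₀, w₀, h0G, h0F⟩ := hsol
  have hres : Tendsto (fun k => t k - x k) atTop (𝓝 0) := by
    -- The decrements of a convergent sequence vanish, and they dominate the residual since `α (2 -
    -- α) > 0`.
    set E : ℕ → ℝ := fun k => B (x k - x₀ + (w k - w₀)) (x k - x₀ + (w k - w₀)) with hE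
    obtain ⟨l, hl⟩ : ∃ l, Tendsto E atTop (𝓝 l) :=
      ⟨_, tendsto_atTop_ciInf (hmono x₀ w₀ h0G h0F) ⟨0, by rintro _ ⟨k, rfl⟩; exact hnn _⟩⟩
    have hd : Tendsto (fun k => (E k - E (k + 1)) / (α * (2 - α))) atTop (𝓝 0) := by
      simpa using (hl.sub (hl.comp (tendsto_add_atTop_nat 1))).div_const (α * (2 - α))
    refine htend _ _ (fun k => (hcoer _).trans ?_) hd
    rw [le_div_iff₀ (mul_pos hα0 (by linarith))]
    linarith [fejer x₀ w₀ h0G h0F k]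
  have hbdd : ∀ z : ℕ → V, ∀ z₀, (∀ k, c * ‖z k - z₀‖ ^ 2 ≤
      B (x k - x₀ + (w k - w₀)) (x k - x₀ + (w k - w₀))) →
      ∃ R, ∀ k, z k ∈ Metric.closedBall z₀ R := by
    intro z z₀ hz
    refine ⟨√(B (x 0 - x₀ + (w 0 - w₀)) (x 0 - x₀ + (w 0 - w₀)) / c), fun k => ?_⟩
    rw [mem_closedBall_iff_norm]
    apply Real.le_sqrt_of_sq_le
    rw [le_div_iff₀ hc]
    have := hmono x₀ w₀ h0G h0F (Nat.zero_le k)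
    simp only at this
    linarith [hz k]
  obtain ⟨R, hR⟩ := hbdd x x₀ fun k => by
    have := hsplit x₀ w₀ h0G k
    have h2 : 0 ≤ c * ‖w k - w₀‖ ^ 2 := by positivity
    linarith
  obtain ⟨R', hR'⟩ := hbdd w w₀ fun k => by
    have := hsplit x₀ w₀ h0G k
    have h2 : 0 ≤ c * ‖x k - x₀‖ ^ 2 := by positivity
    linarith
  obtain ⟨⟨a, b⟩, -, φ, hφ, hlim⟩ := ((isCompact_closedBall x₀ R).prod
    (isCompact_closedBall w₀ R')).tendsto_subseq (x := fun k => (x k, w k))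
      fun k => ⟨hR k, hR' k⟩
  have ha : Tendsto (fun k => x (φ k)) atTop (𝓝 a) := (continuous_fst.tendsto _).comp hlim
  have hb : Tendsto (fun k => w (φ k)) atTop (𝓝 b) := (continuous_snd.tendsto _).comp hlim
  have hresφ := hres.comp hφ.tendsto_atTop
  have htφ : Tendsto (fun k => t (φ k)) atTop (𝓝 a) := by
    have := hresφ.add ha
    rw [zero_add] at this
    exact this.congr fun k => by simp
  have habG : (a, b) ∈ G := hGc.mem_of_tendsto hlim (Eventually.of_forall fun k => hxw _)
  have habF : (a, -b) ∈ F := by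
    refine hFc.mem_of_tendsto (f := fun k => (t (φ k), x (φ k) - t (φ k) - w (φ k)))
      (b := atTop) ?_ (Eventually.of_forall fun k => ht _)
    have h1 := (ha.sub htφ).sub hb
    rw [sub_self, zero_sub] at h1
    exact htφ.prodMk_nhds h1
  -- The cluster point is itself a solution, so the distance to it is antitone; it vanishes along
  -- the subsequence, hence along the whole sequence.
  have hE0 : Tendsto (fun k => B (x k - a + (w k - b)) (x k - a + (w k - b))) atTop (𝓝 0) := by
    have hl := tendsto_atTop_ciInf (hmono a b habG habF)
      ⟨0, by rintro _ ⟨k, rfl⟩; exact hnn _⟩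
    have h1 : Tendsto (fun k => B (x (φ k) - a + (w (φ k) - b)) (x (φ k) - a + (w (φ k) - b)))
        atTop (𝓝 0) := by
      have h2 := (ha.sub_const a).add (hb.sub_const b)
      rw [sub_self, sub_self, add_zero] at h2
      have h3 := (hcont.tendsto 0).comp h2
      rw [map_zero] at h3
      exact h3
    rwa [tendsto_nhds_unique (hl.comp hφ.tendsto_atTop) h1] at hl
  have hx : Tendsto x atTop (𝓝 a) := by
    refine tendsto_sub_nhds_zero_iff.1 (htend _ _ (fun k => ?_) hE0)
    have := hsplit a b habG k
    have h2 : 0 ≤ c * ‖w k - b‖ ^ 2 := by positivity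
    linarith
  have hw : Tendsto w atTop (𝓝 b) := by
    refine tendsto_sub_nhds_zero_iff.1 (htend _ _ (fun k => ?_) hE0)
    have := hsplit a b habG k
    have h2 : 0 ≤ c * ‖x k - a‖ ^ 2 := by positivity
    linarith
  refine ⟨a, b, habG, habF, hx, hw, ?_⟩
  have := hres.add hx
  rw [zero_add] at this
  exact this.congr fun k => by simp

end DouglasRachford

/-! ### Algebra of stacked vectors -/

namespace Block

variable {n m p : ℕ}

@[simp] theorem x_add (u v : Block n m p) : (u + v).x = u.x + v.x := rfl
@[simp] theorem s_add (u v : Block n m p) : (u + v).s = u.s + v.s := rfl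
@[simp] theorem zI_add (u v : Block n m p) : (u + v).zI = u.zI + v.zI := rfl
@[simp] theorem zE_add (u v : Block n m p) : (u + v).zE = u.zE + v.zE := rfl
@[simp] theorem x_sub (u v : Block n m p) : (u - v).x = u.x - v.x := rfl
@[simp] theorem s_sub (u v : Block n m p) : (u - v).s = u.s - v.s := rfl
@[simp] theorem zI_sub (u v : Block n m p) : (u - v).zI = u.zI - v.zI := rfl
@[simp] theorem zE_sub (u v : Block n m p) : (u - v).zE = u.zE - v.zE := rfl
@[simp] theorem x_neg (u : Block n m p) : (-u).x = -u.x := rfl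
@[simp] theorem s_neg (u : Block n m p) : (-u).s = -u.s := rfl
@[simp] theorem zI_neg (u : Block n m p) : (-u).zI = -u.zI := rfl
@[simp] theorem zE_neg (u : Block n m p) : (-u).zE = -u.zE := rfl
@[simp] theorem x_smul (c : ℝ) (u : Block n m p) : (c • u).x = c • u.x := rfl
@[simp] theorem s_smul (c : ℝ) (u : Block n m p) : (c • u).s = c • u.s := rfl
@[simp] theorem zI_smul (c : ℝ) (u : Block n m p) : (c • u).zI = c • u.zI := rfl
@[simp] theorem zE_smul (c : ℝ) (u : Block n m p) : (c • u).zE = c • u.zE := rfl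
@[simp] theorem x_mk (a : Fin n → ℝ) (b c : Fin m → ℝ) (d : Fin p → ℝ) :
    x (a, b, c, d) = a := rfl
@[simp] theorem s_mk (a : Fin n → ℝ) (b c : Fin m → ℝ) (d : Fin p → ℝ) :
    s (a, b, c, d) = b := rfl
@[simp] theorem zI_mk (a : Fin n → ℝ) (b c : Fin m → ℝ) (d : Fin p → ℝ) :
    zI (a, b, c, d) = c := rfl
@[simp] theorem zE_mk (a : Fin n → ℝ) (b c : Fin m → ℝ) (d : Fin p → ℝ) :
    zE (a, b, c, d) = d := rfl

@[fun_prop] theorem continuous_x : Continuous (x : Block n m p → _) := continuous_fst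
@[fun_prop] theorem continuous_s : Continuous (s : Block n m p → _) := by unfold s; fun_prop
@[fun_prop] theorem continuous_zI : Continuous (zI : Block n m p → _) := by unfold zI; fun_prop
@[fun_prop] theorem continuous_zE : Continuous (zE : Block n m p → _) := by unfold zE; fun_prop

theorem ext {u v : Block n m p} (h1 : u.x = v.x) (h2 : u.s = v.s) (h3 : u.zI = v.zI)
    (h4 : u.zE = v.zE) : u = v :=
  Prod.ext h1 (Prod.ext h2 (Prod.ext h3 h4))

/-- The Euclidean inner product of two stacked vectors. -/
def dot (u v : Block n m p) : ℝ :=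
  u.x ⬝ᵥ v.x + u.s ⬝ᵥ v.s + u.zI ⬝ᵥ v.zI + u.zE ⬝ᵥ v.zE

theorem dot_sub (u v w : Block n m p) : dot u (v - w) = dot u v - dot u w := by
  simp only [dot, x_sub, s_sub, zI_sub, zE_sub, dotProduct_sub]; ring

theorem sub_dot (u v w : Block n m p) : dot (u - v) w = dot u w - dot v w := by
  simp only [dot, x_sub, s_sub, zI_sub, zE_sub, sub_dotProduct]; ring

theorem neg_dot (u v : Block n m p) : dot (-u) v = -dot u v := by
  simp only [dot, x_neg, s_neg, zI_neg, zE_neg, neg_dotProduct]; ring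

theorem dot_comm (u v : Block n m p) : dot u v = dot v u := by
  simp only [dot, dotProduct_comm]

end Block

/-! ### Subdifferentials of the two parts of the objective -/

section Subdifferential

variable {n m p : ℕ}

/-- The objective of the second block on its domain. -/
noncomputable def penalty (muI muE : ℝ) (v : Block n m p) : ℝ := muI * l1 v.zI + muE * l1 v.zE

/-- `v` satisfies the affine constraints in the domain of `f`. -/
def Feasible (Q : QP n m p) (v : Block n m p) : Prop :=
  v.zI = Q.G *ᵥ v.x + v.s - Q.h ∧ v.zE = Q.A *ᵥ v.x - Q.b

/-- `y` is a subgradient at `v` of the second part `g` of the objective. -/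
structure SubG (muI muE : ℝ) (v y : Block n m p) : Prop where
  y_x : y.x = 0
  s_nonneg : 0 ≤ v.s
  y_s : y.s ≤ 0
  y_s_mul : ∀ i, y.s i * v.s i = 0
  y_zI : ∀ i, |y.zI i| ≤ muI
  y_zI_mul : ∀ i, y.zI i * v.zI i = muI * |v.zI i|
  y_zE : ∀ i, |y.zE i| ≤ muE
  y_zE_mul : ∀ i, y.zE i * v.zE i = muE * |v.zE i|

/-- `y` is a subgradient at `v` of the first part `f` of the objective. -/
structure SubF (Q : QP n m p) (v y : Block n m p) : Prop where
  feasible : Feasible Q v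
  y_zI : y.zI = -y.s
  y_x : y.x = Q.P *ᵥ v.x + Q.q + Q.Gᵀ *ᵥ y.s - Q.Aᵀ *ᵥ y.zE

theorem sum_mul_le_l1 {d : ℕ} {μ : ℝ} {y : Fin d → ℝ} (hy : ∀ i, |y i| ≤ μ) (v : Fin d → ℝ) :
    y ⬝ᵥ v ≤ μ * l1 v := by
  rw [l1, Finset.mul_sum]
  refine Finset.sum_le_sum fun i _ => ?_
  calc y i * v i ≤ |y i * v i| := le_abs_self _
    _ = |y i| * |v i| := abs_mul _ _
    _ ≤ μ * |v i| := mul_le_mul_of_nonneg_right (hy i) (abs_nonneg _)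

theorem sum_mul_eq_l1 {d : ℕ} {μ : ℝ} {y v : Fin d → ℝ} (hy : ∀ i, y i * v i = μ * |v i|) :
    y ⬝ᵥ v = μ * l1 v := by
  rw [l1, Finset.mul_sum]
  exact Finset.sum_congr rfl fun i _ => hy i

theorem SubG.le {muI muE : ℝ} {v y : Block n m p} (h : SubG muI muE v y) {v' : Block n m p}
    (hv' : 0 ≤ v'.s) :
    penalty muI muE v + Block.dot y (v' - v) ≤ penalty muI muE v' := by
  have h1 := sum_mul_le_l1 h.y_zI v'.zI
  have h2 := sum_mul_le_l1 h.y_zE v'.zE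
  have h3 := sum_mul_eq_l1 h.y_zI_mul
  have h4 := sum_mul_eq_l1 h.y_zE_mul
  have h5 : y.s ⬝ᵥ v'.s ≤ 0 :=
    Finset.sum_nonpos fun i _ => mul_nonpos_of_nonpos_of_nonneg (h.y_s i) (hv' i)
  have h6 : y.s ⬝ᵥ v.s = 0 := Finset.sum_eq_zero fun i _ => h.y_s_mul i
  rw [Block.dot_sub]
  simp only [penalty, Block.dot, h.y_x, zero_dotProduct]
  linarith

/-- On the affine domain of `f` the `s`, `z_I` and `z_E` contributions cancel against the `G` and
`A` terms of `y.x`, which leaves the gradient inequality for the convex quadratic. -/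
theorem SubF.le {Q : QP n m p} (hP : Q.P.PosSemidef) {v y : Block n m p} (h : SubF Q v y)
    {v' : Block n m p} (hv' : Feasible Q v') :
    quad Q v.x + Block.dot y (v' - v) ≤ quad Q v'.x := by
  have hPt : Q.Pᵀ = Q.P := by
    rw [← conjTranspose_eq_transpose_of_trivial, hP.isHermitian.eq]
  have h1 : 0 ≤ (v'.x - v.x) ⬝ᵥ (Q.P *ᵥ (v'.x - v.x)) := by
    simpa using hP.dotProduct_mulVec_nonneg (v'.x - v.x)
  have h2 : v.x ⬝ᵥ (Q.P *ᵥ v'.x) = v'.x ⬝ᵥ (Q.P *ᵥ v.x) := by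
    rw [← mulVec_dotProduct_comm hPt, dotProduct_comm]
  have h3 : (Q.P *ᵥ v.x) ⬝ᵥ v'.x = v'.x ⬝ᵥ (Q.P *ᵥ v.x) := dotProduct_comm _ _
  have h4 : (Q.P *ᵥ v.x) ⬝ᵥ v.x = v.x ⬝ᵥ (Q.P *ᵥ v.x) := dotProduct_comm _ _
  simp only [Block.dot, Block.x_sub, Block.s_sub, Block.zI_sub, Block.zE_sub, h.y_x, h.y_zI,
    h.feasible.1, h.feasible.2, hv'.1, hv'.2, quad]
  simp only [mulVec_sub, dotProduct_sub, sub_dotProduct, dotProduct_add, add_dotProduct,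
    neg_dotProduct, transpose_mulVec_dotProduct] at *
  linarith

theorem SubG.monotone {muI muE : ℝ} {v y v' y' : Block n m p} (h : SubG muI muE v y)
    (h' : SubG muI muE v' y') : 0 ≤ Block.dot (v - v') (y - y') := by
  have h1 := h.le h'.s_nonneg
  have h2 := h'.le h.s_nonneg
  simp only [Block.dot_sub, Block.sub_dot] at *
  rw [Block.dot_comm v y, Block.dot_comm v' y, Block.dot_comm v y', Block.dot_comm v' y']
  linarith

theorem SubF.monotone {Q : QP n m p} (hP : Q.P.PosSemidef) {v y v' y' : Block n m p}
    (h : SubF Q v y) (h' : SubF Q v' y') : 0 ≤ Block.dot (v - v') (y - y') := by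
  have h1 := h.le hP h'.feasible
  have h2 := h'.le hP h.feasible
  simp only [Block.dot_sub, Block.sub_dot] at *
  rw [Block.dot_comm v y, Block.dot_comm v' y, Block.dot_comm v y', Block.dot_comm v' y']
  linarith

theorem isClosed_subG (muI muE : ℝ) :
    IsClosed {a : Block n m p × Block n m p | SubG muI muE a.1 a.2} := by
  have : {a : Block n m p × Block n m p | SubG muI muE a.1 a.2} =
      {a | a.2.x = 0} ∩ {a | 0 ≤ a.1.s} ∩ {a | a.2.s ≤ 0} ∩ (⋂ i, {a | a.2.s i * a.1.s i = 0}) ∩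
      (⋂ i, {a | |a.2.zI i| ≤ muI}) ∩ (⋂ i, {a | a.2.zI i * a.1.zI i = muI * |a.1.zI i|}) ∩
      (⋂ i, {a | |a.2.zE i| ≤ muE}) ∩ (⋂ i, {a | a.2.zE i * a.1.zE i = muE * |a.1.zE i|}) := by
    ext a
    simp only [Set.mem_ofPred_eq, Set.mem_inter_iff, Set.mem_iInter]
    exact ⟨fun ⟨h1, h2, h3, h4, h5, h6, h7, h8⟩ => ⟨⟨⟨⟨⟨⟨⟨h1, h2⟩, h3⟩, h4⟩, h5⟩, h6⟩, h7⟩, h8⟩,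
      fun ⟨⟨⟨⟨⟨⟨⟨h1, h2⟩, h3⟩, h4⟩, h5⟩, h6⟩, h7⟩, h8⟩ => ⟨h1, h2, h3, h4, h5, h6, h7, h8⟩⟩
  rw [this]
  refine (((((((isClosed_eq ?_ ?_).inter (isClosed_le ?_ ?_)).inter (isClosed_le ?_ ?_)).inter
    (isClosed_iInter fun i => isClosed_eq ?_ ?_)).inter
    (isClosed_iInter fun i => isClosed_le ?_ ?_)).inter
    (isClosed_iInter fun i => isClosed_eq ?_ ?_)).inter
    (isClosed_iInter fun i => isClosed_le ?_ ?_)).inter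
    (isClosed_iInter fun i => isClosed_eq ?_ ?_) <;> fun_prop

theorem isClosed_subF (Q : QP n m p) :
    IsClosed {a : Block n m p × Block n m p | SubF Q a.1 a.2} := by
  have : {a : Block n m p × Block n m p | SubF Q a.1 a.2} =
      {a | a.1.zI = Q.G *ᵥ a.1.x + a.1.s - Q.h} ∩ {a | a.1.zE = Q.A *ᵥ a.1.x - Q.b} ∩
      {a | a.2.zI = -a.2.s} ∩
      {a | a.2.x = Q.P *ᵥ a.1.x + Q.q + Q.Gᵀ *ᵥ a.2.s - Q.Aᵀ *ᵥ a.2.zE} := by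
    ext a
    simp only [Set.mem_ofPred_eq, Set.mem_inter_iff]
    exact ⟨fun ⟨⟨h1, h2⟩, h3, h4⟩ => ⟨⟨⟨h1, h2⟩, h3⟩, h4⟩,
      fun ⟨⟨⟨h1, h2⟩, h3⟩, h4⟩ => ⟨⟨h1, h2⟩, h3, h4⟩⟩
  rw [this]
  refine (((isClosed_eq ?_ ?_).inter (isClosed_eq ?_ ?_)).inter (isClosed_eq ?_ ?_)).inter
    (isClosed_eq ?_ ?_) <;> fun_prop

end Subdifferential

/-! ### From subgradients to saddle points and minimizers -/

section Saddle

variable {n m p : ℕ}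

theorem ind_of_true {c : Prop} (h : c) : ind c = 0 := if_pos h

theorem ind_of_false {c : Prop} (h : ¬c) : ind c = ⊤ := if_neg h

theorem ind_ne_bot (c : Prop) : ind c ≠ ⊥ := by
  unfold ind; split_ifs <;> simp

theorem f_of_feasible {Q : QP n m p} {v : Block n m p} (h : Feasible Q v) :
    f Q v = (quad Q v.x : EReal) := by
  rw [f, ind_of_true h.1, ind_of_true h.2, add_zero, add_zero]

theorem f_of_not_feasible {Q : QP n m p} {v : Block n m p} (h : ¬Feasible Q v) : f Q v = ⊤ := by
  rw [f]
  by_cases h1 : v.zI = Q.G *ᵥ v.x + v.s - Q.h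
  · rw [ind_of_true h1, ind_of_false fun h2 => h ⟨h1, h2⟩, add_zero, EReal.coe_add_top]
  · rw [ind_of_false h1, EReal.coe_add_top, EReal.top_add_of_ne_bot (ind_ne_bot _)]

theorem f_ne_bot (Q : QP n m p) (v : Block n m p) : f Q v ≠ ⊥ := by
  by_cases h : Feasible Q v
  · rw [f_of_feasible h]; exact EReal.coe_ne_bot _
  · rw [f_of_not_feasible h]; exact top_ne_bot

theorem g_of_nonneg {muI muE : ℝ} {v : Block n m p} (h : 0 ≤ v.s) :
    g muI muE v = (penalty muI muE v : EReal) := by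
  rw [g, ind_of_true h, zero_add, penalty]

theorem g_of_not_nonneg {muI muE : ℝ} {v : Block n m p} (h : ¬0 ≤ v.s) :
    g muI muE v = ⊤ := by
  rw [g, ind_of_false h, EReal.top_add_coe]

theorem g_ne_bot (muI muE : ℝ) (v : Block n m p) : g muI muE v ≠ ⊥ := by
  by_cases h : 0 ≤ v.s
  · rw [g_of_nonneg h]; exact EReal.coe_ne_bot _
  · rw [g_of_not_nonneg h]; exact top_ne_bot

theorem lagrangian_eq_coe {Q : QP n m p} {muI muE : ℝ} {xt x : Block n m p} (hxt : Feasible Q xt)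
    (hx : 0 ≤ x.s) (y : Block n m p) : lagrangian Q muI muE xt x y =
      ((quad Q xt.x + penalty muI muE x + Block.dot y (xt - x) : ℝ) : EReal) := by
  rw [lagrangian, f_of_feasible hxt, g_of_nonneg hx, EReal.coe_add, EReal.coe_add]
  rfl

theorem lagrangian_eq_top {Q : QP n m p} {muI muE : ℝ} {xt x : Block n m p}
    (h : ¬(Feasible Q xt ∧ 0 ≤ x.s)) (y : Block n m p) : lagrangian Q muI muE xt x y = ⊤ := by
  rw [lagrangian]
  by_cases h1 : Feasible Q xt
  · rw [g_of_not_nonneg fun h2 => h ⟨h1, h2⟩, EReal.add_top_of_ne_bot (f_ne_bot _ _),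
      EReal.top_add_coe]
  · rw [f_of_not_feasible h1, EReal.top_add_of_ne_bot (g_ne_bot _ _ _), EReal.top_add_coe]

/-- Sum of the subgradient inequalities for `y` and `-y`; the terms in `y` at the base point cancel.
-/
theorem penalized_le {Q : QP n m p} (hP : Q.P.PosSemidef) {muI muE : ℝ} {x y : Block n m p}
    (hG : SubG muI muE x y) (hF : SubF Q x (-y)) {xt' x' : Block n m p} (hxt : Feasible Q xt')
    (hx : 0 ≤ x'.s) : quad Q x.x + penalty muI muE x ≤
      quad Q xt'.x + penalty muI muE x' + Block.dot y (xt' - x') := by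
  have h1 := hG.le hx
  have h2 := hF.le hP hxt
  simp only [Block.neg_dot, Block.dot_sub] at *
  linarith

/-- With both primal blocks equal, the Lagrangian does not depend on the multiplier, so the
maximization over `y'` holds with equality. -/
theorem isSaddle_of_subgradients {Q : QP n m p} (hP : Q.P.PosSemidef) {muI muE : ℝ}
    {x y : Block n m p} (hG : SubG muI muE x y) (hF : SubF Q x (-y)) :
    IsSaddle Q muI muE x x y := by
  constructor
  · intro y'
    rw [lagrangian_eq_coe hF.feasible hG.s_nonneg, lagrangian_eq_coe hF.feasible hG.s_nonneg,
      EReal.coe_le_coe_iff, Block.dot_sub, Block.dot_sub, sub_self, sub_self]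
  · intro xt' x'
    by_cases h : Feasible Q xt' ∧ 0 ≤ x'.s
    · rw [lagrangian_eq_coe hF.feasible hG.s_nonneg, lagrangian_eq_coe h.1 h.2,
        EReal.coe_le_coe_iff, Block.dot_sub, sub_self, add_zero]
      exact penalized_le hP hG hF h.1 h.2
    · rw [lagrangian_eq_top h]
      exact le_top

theorem phi_le_of_subgradients {Q : QP n m p} (hP : Q.P.PosSemidef) {muI muE : ℝ}
    {x y : Block n m p} (hG : SubG muI muE x y) (hF : SubF Q x (-y)) (x' : Fin n → ℝ)
    (s' : Fin m → ℝ) (hs' : 0 ≤ s') : phi Q muI muE x.x x.s ≤ phi Q muI muE x' s' := by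
  -- Using the same feasible lift of `(x', s')` for both blocks makes the coupling term vanish.
  let v : Block n m p := (x', s', Q.G *ᵥ x' + s' - Q.h, Q.A *ᵥ x' - Q.b)
  have h := penalized_le hP hG hF (xt' := v) (x' := v) ⟨rfl, rfl⟩ hs'
  rw [Block.dot_sub, sub_self, add_zero, penalty, penalty, hF.feasible.1, hF.feasible.2] at h
  rw [phi, phi, add_assoc, add_assoc]
  exact h

end Saddle

/-! ### Existence of a primal-dual solution -/

section Existence

variable {n m p : ℕ}

/-- If `φ` is bounded below on `s ≥ 0` then the split problem has a primal-dual solution. -/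
theorem exists_subgradients (Q : QP n m p) (hP : Q.P.PosSemidef) {muI muE : ℝ}
    (hmuI : 0 < muI) (hmuE : 0 < muE)
    (hbdd : ∃ B : ℝ, ∀ (x : Fin n → ℝ) (s : Fin m → ℝ), 0 ≤ s → B ≤ phi Q muI muE x s) :
    ∃ x y : Block n m p, SubG muI muE x y ∧ SubF Q x (-y) := by
  obtain ⟨B, hB⟩ := hbdd
  have hI : ∀ {u r : ℝ}, 0 ≤ u → u ≤ muI → 0 ≤ u * r → 0 ≤ (u - muI) * r →
      u * r = muI * |r + max (-r) 0| := by
    intro u r h0 h1 h2 h3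
    rcases le_total r 0 with h | h
    · rw [max_eq_left (by linarith), add_neg_cancel, abs_zero, mul_zero]
      nlinarith
    · rw [max_eq_right (by linarith), add_zero, abs_of_nonneg h]
      nlinarith
  have hE : ∀ {u r : ℝ}, -muE ≤ u → u ≤ muE → 0 ≤ (u - -muE) * r → 0 ≤ (u - muE) * r →
      u * r = muE * |r| := by
    intro u r h0 h1 h2 h3
    rcases le_total r 0 with h | h
    · rw [abs_of_nonpos h]; nlinarith
    · rw [abs_of_nonneg h]; nlinarith
  -- Minimizing over `s ≥ 0` turns `μ_I |r + s|` into `μ_I max(r, 0)`, the support function of `[0,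
  -- μ_I]`; the equality penalty is that of `[-μ_E, μ_E]`. The slack `s = max(-r, 0)` attains this
  -- minimum, so the bound on `φ` applies to the reduced problem.
  obtain ⟨x, w, ⟨⟨hlo, hhi⟩, hc⟩, heq⟩ := exists_kkt hP Q.q (fromRows Q.G Q.A) (Sum.elim Q.h Q.b)
    (Sum.elim 0 fun _ => -muE) (Sum.elim (fun _ => muI) fun _ => muE)
    (by rintro (i | i) <;> simp <;> linarith) B (by
      rintro x w ⟨⟨hlo, hhi⟩, hc⟩
      refine (hB x (fun i => max (-(Q.G *ᵥ x - Q.h) i) 0) fun i => le_max_right _ _).trans_eq ?_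
      rw [phi, quad, add_assoc _ (muI * _)]
      congr 1
      rw [dotProduct, Fintype.sum_sum_type, l1, l1, Finset.mul_sum, Finset.mul_sum]
      congr 1
      · refine Finset.sum_congr rfl fun i _ => ?_
        have h1 := hlo (.inl i)
        have h2 := hhi (.inl i)
        have h3 := hc (.inl i)
        simp only [fromRows_mulVec, Pi.sub_apply, Sum.elim_inl, Pi.zero_apply, sub_zero] at *
        have h4 := hI h1 h2 h3.1 h3.2
        rw [h4]
        simp only [Pi.add_apply]
        congr 2
        ring
      · refine Finset.sum_congr rfl fun i _ => ?_
        have h1 := hlo (.inr i)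
        have h2 := hhi (.inr i)
        have h3 := hc (.inr i)
        simp only [fromRows_mulVec, Pi.sub_apply, Sum.elim_inr] at *
        exact (hE h1 h2 h3.1 h3.2).symm)
  set s : Fin m → ℝ := fun i => max (-(Q.G *ᵥ x - Q.h) i) 0 with hs
  set u : Fin m → ℝ := fun i => w (.inl i) with hu
  set v : Fin p → ℝ := fun i => w (.inr i) with hv
  have huI : ∀ i, 0 ≤ u i ∧ u i ≤ muI ∧ 0 ≤ u i * (Q.G *ᵥ x - Q.h) i ∧
      0 ≤ (u i - muI) * (Q.G *ᵥ x - Q.h) i := fun i => by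
    have h1 := hlo (.inl i)
    have h2 := hhi (.inl i)
    have h3 := hc (.inl i)
    simp only [fromRows_mulVec, Pi.sub_apply, Sum.elim_inl, Pi.zero_apply, sub_zero] at h1 h2 h3
    exact ⟨h1, h2, h3⟩
  have hvE : ∀ i, -muE ≤ v i ∧ v i ≤ muE ∧ 0 ≤ (v i - -muE) * (Q.A *ᵥ x - Q.b) i ∧
      0 ≤ (v i - muE) * (Q.A *ᵥ x - Q.b) i := fun i => by
    have h1 := hlo (.inr i)
    have h2 := hhi (.inr i)
    have h3 := hc (.inr i)
    simp only [fromRows_mulVec, Pi.sub_apply, Sum.elim_inr] at h1 h2 h3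
    exact ⟨h1, h2, h3⟩
  refine ⟨(x, s, Q.G *ᵥ x + s - Q.h, Q.A *ᵥ x - Q.b), (0, -u, u, v),
    ⟨rfl, fun i => le_max_right _ _, fun i => ?_, fun i => ?_, fun i => ?_, fun i => ?_,
      fun i => ?_, fun i => ?_⟩, ⟨⟨rfl, rfl⟩, ?_, ?_⟩⟩ <;>
    simp only [Block.x_neg, Block.s_neg, Block.zI_neg, Block.zE_neg, Block.x_mk, Block.s_mk,
      Block.zI_mk, Block.zE_mk]
  · simpa using (huI i).1
  · obtain ⟨h1, h2, h3, h4⟩ := huI i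
    simp only [hs, Pi.neg_apply]
    rcases le_total 0 ((Q.G *ᵥ x - Q.h) i) with h | h
    · rw [max_eq_right (by linarith), mul_zero]
    · rw [max_eq_left (by linarith)]; nlinarith
  · rw [abs_of_nonneg (huI i).1]; exact (huI i).2.1
  · obtain ⟨h1, h2, h3, h4⟩ := huI i
    have h5 : (Q.G *ᵥ x + s - Q.h) i
        = (Q.G *ᵥ x - Q.h) i + max (-(Q.G *ᵥ x - Q.h) i) 0 := by
      simp only [hs, Pi.sub_apply, Pi.add_apply]; ring
    rw [h5, ← hI h1 h2 h3 h4]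
    rcases le_total 0 ((Q.G *ᵥ x - Q.h) i) with h | h
    · rw [max_eq_right (by linarith), add_zero]
    · rw [max_eq_left (by linarith)]; nlinarith
  · exact abs_le.2 ⟨(hvE i).1, (hvE i).2.1⟩
  · exact hE (hvE i).1 (hvE i).2.1 (hvE i).2.2.1 (hvE i).2.2.2
  · simp
  · rw [transpose_fromRows, fromCols_mulVec] at heq
    rw [neg_neg, neg_zero, mulVec_neg, sub_neg_eq_add, add_assoc]
    exact heq.symm

end Existence

theorem self_dotProduct_nonneg {ι : Type*} [Fintype ι] (v : ι → ℝ) : 0 ≤ v ⬝ᵥ v :=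
  Finset.sum_nonneg fun _ _ => mul_self_nonneg _

/-! ### Existence and uniqueness of the iterates -/

section Run

variable {n m p : ℕ}

theorem existsUnique_solvesSystem (Q : QP n m p) (hP : Q.P.PosSemidef) (θ : Params)
    (hsigmaX : 0 < θ.sigmaX) (hsigmaS : 0 < θ.sigmaS) (hrhoI : 0 < θ.rhoI) (hrhoE : 0 < θ.rhoE)
    (u : State n m p) : ∃! z : (Fin n → ℝ) × (Fin m → ℝ) × (Fin p → ℝ),
      SolvesSystem Q θ u z.1 z.2.1 z.2.2 := by
  let L : ((Fin n → ℝ) × (Fin m → ℝ) × (Fin p → ℝ)) →ₗ[ℝ]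
      ((Fin n → ℝ) × (Fin m → ℝ) × (Fin p → ℝ)) :=
    { toFun := fun z => ((Q.P + θ.sigmaX • (1 : Matrix (Fin n) (Fin n) ℝ)) *ᵥ z.1
          + Q.Gᵀ *ᵥ z.2.1 + Q.Aᵀ *ᵥ z.2.2,
        Q.G *ᵥ z.1 - (θ.sigmaS⁻¹ + θ.rhoI⁻¹) • z.2.1, Q.A *ᵥ z.1 - θ.rhoE⁻¹ • z.2.2)
      map_add' := fun a b => by
        refine Prod.ext ?_ (Prod.ext ?_ ?_) <;>
          simp only [Prod.fst_add, Prod.snd_add, mulVec_add, smul_add] <;> abel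
      map_smul' := fun c a => by
        refine Prod.ext ?_ (Prod.ext ?_ ?_) <;>
          simp only [Prod.smul_fst, Prod.smul_snd, mulVec_smul, smul_add, smul_sub,
            RingHom.id_apply, smul_comm c] }
  -- Pair the first homogeneous row with `x` and substitute the other two: a sum of nonnegative
  -- quadratic terms, definite in all three unknowns, is zero.
  have hinj : Function.Injective L := by
    rw [injective_iff_map_eq_zero]
    rintro ⟨x, a, b⟩ h
    have h1 : (Q.P + θ.sigmaX • (1 : Matrix (Fin n) (Fin n) ℝ)) *ᵥ x
      + Q.Gᵀ *ᵥ a + Q.Aᵀ *ᵥ b = 0 := congrArg Prod.fst h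
    have h2 : Q.G *ᵥ x - (θ.sigmaS⁻¹ + θ.rhoI⁻¹) • a = 0 := congrArg (fun z => z.2.1) h
    have h3 : Q.A *ᵥ x - θ.rhoE⁻¹ • b = 0 := congrArg (fun z => z.2.2) h
    have h4 := congrArg (fun v => v ⬝ᵥ x) h1
    simp only [add_dotProduct, add_mulVec, smul_mulVec, one_mulVec, zero_dotProduct,
      transpose_mulVec_dotProduct, sub_eq_zero.1 h2, sub_eq_zero.1 h3, smul_dotProduct,
      dotProduct_smul, smul_eq_mul] at h4
    have h5 : 0 ≤ (Q.P *ᵥ x) ⬝ᵥ x := by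
      rw [dotProduct_comm]; simpa using hP.dotProduct_mulVec_nonneg x
    have hx := self_dotProduct_nonneg x
    have ha := self_dotProduct_nonneg a
    have hb := self_dotProduct_nonneg b
    have hc1 : 0 < θ.sigmaS⁻¹ + θ.rhoI⁻¹ := by positivity
    have hc2 : 0 < θ.rhoE⁻¹ := by positivity
    have hx' := mul_nonneg hsigmaX.le hx
    have ha' := mul_nonneg hc1.le ha
    have hb' := mul_nonneg hc2.le hb
    have ex : θ.sigmaX * (x ⬝ᵥ x) = 0 := by linarith
    have ea : (θ.sigmaS⁻¹ + θ.rhoI⁻¹) * (a ⬝ᵥ a) = 0 := by linarith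
    have eb : θ.rhoE⁻¹ * (b ⬝ᵥ b) = 0 := by linarith
    rw [mul_eq_zero_iff_left (by positivity), dotProduct_self_eq_zero] at ex ea eb
    rw [ex, ea, eb]
    rfl
  have hbij : Function.Bijective L := ⟨hinj, LinearMap.injective_iff_surjective.1 hinj⟩
  have hiff : ∀ z : (Fin n → ℝ) × (Fin m → ℝ) × (Fin p → ℝ), SolvesSystem Q θ u z.1 z.2.1 z.2.2 ↔
      L z = (θ.sigmaX • u.x - Q.q, Q.h - u.s + θ.sigmaS⁻¹ • u.ws + u.zI - θ.rhoI⁻¹ • u.yI,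
        Q.b + u.zE - θ.rhoE⁻¹ • u.yE) := fun z =>
    ⟨fun h => Prod.ext h.1 (Prod.ext h.2 h.3), fun h => ⟨congrArg Prod.fst h,
      congrArg (fun z => z.2.1) h, congrArg (fun z => z.2.2) h⟩⟩
  simp only [hiff]
  exact hbij.existsUnique _

theorem State.ext' {u v : State n m p} (h1 : u.x = v.x) (h2 : u.s = v.s) (h3 : u.zI = v.zI)
    (h4 : u.zE = v.zE) (h5 : u.ws = v.ws) (h6 : u.yI = v.yI) (h7 : u.yE = v.yE) : u = v := by
  cases u; cases v; simp_all

theorem exists_isStep (Q : QP n m p) (hP : Q.P.PosSemidef) (θ : Params)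
    (hsigmaX : 0 < θ.sigmaX) (hsigmaS : 0 < θ.sigmaS) (hrhoI : 0 < θ.rhoI) (hrhoE : 0 < θ.rhoE)
    (u : State n m p) : ∃ nuI nuE t v, IsStep Q θ u nuI nuE t v := by
  obtain ⟨⟨x, nuI, nuE⟩, h, -⟩ :=
    existsUnique_solvesSystem Q hP θ hsigmaX hsigmaS hrhoI hrhoE u
  let t : Block n m p := (x, u.s - θ.sigmaS⁻¹ • u.ws - θ.sigmaS⁻¹ • nuI,
    u.zI - θ.rhoI⁻¹ • u.yI + θ.rhoI⁻¹ • nuI, u.zE - θ.rhoE⁻¹ • u.yE + θ.rhoE⁻¹ • nuE)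
  let s := relu (θ.alpha • t.s + (1 - θ.alpha) • u.s + θ.sigmaS⁻¹ • u.ws)
  let zI := soft (θ.muI / θ.rhoI)
      (θ.alpha • t.zI + (1 - θ.alpha) • u.zI + θ.rhoI⁻¹ • u.yI)
  let zE := soft (θ.muE / θ.rhoE)
      (θ.alpha • t.zE + (1 - θ.alpha) • u.zE + θ.rhoE⁻¹ • u.yE)
  exact ⟨nuI, nuE, t, ⟨θ.alpha • t.x + (1 - θ.alpha) • u.x, s, zI, zE,
    u.ws + θ.sigmaS • (θ.alpha • t.s + (1 - θ.alpha) • u.s - s),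
    u.yI + θ.rhoI • (θ.alpha • t.zI + (1 - θ.alpha) • u.zI - zI),
    u.yE + θ.rhoE • (θ.alpha • t.zE + (1 - θ.alpha) • u.zE - zE)⟩,
    h, rfl, rfl, rfl, rfl, rfl, rfl, rfl, rfl, rfl, rfl⟩

theorem IsStep.unique {Q : QP n m p} (hP : Q.P.PosSemidef) {θ : Params}
    (hsigmaX : 0 < θ.sigmaX) (hsigmaS : 0 < θ.sigmaS) (hrhoI : 0 < θ.rhoI) (hrhoE : 0 < θ.rhoE)
    {u : State n m p} {nuI nuI' : Fin m → ℝ} {nuE nuE' : Fin p → ℝ} {t t' : Block n m p}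
    {v v' : State n m p} (h : IsStep Q θ u nuI nuE t v) (h' : IsStep Q θ u nuI' nuE' t' v') :
    nuI = nuI' ∧ nuE = nuE' ∧ t = t' ∧ v = v' := by
  have hz := (existsUnique_solvesSystem Q hP θ hsigmaX hsigmaS hrhoI hrhoE u).unique
    (y₁ := (t.x, nuI, nuE)) (y₂ := (t'.x, nuI', nuE')) h.system h'.system
  simp only [Prod.mk.injEq] at hz
  obtain ⟨hx, rfl, rfl⟩ := hz
  obtain rfl : t = t' := Block.ext hx (h.tilde_s.trans h'.tilde_s.symm)
    (h.tilde_zI.trans h'.tilde_zI.symm) (h.tilde_zE.trans h'.tilde_zE.symm)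
  have hs := h.next_s.trans h'.next_s.symm
  have hzI := h.next_zI.trans h'.next_zI.symm
  have hzE := h.next_zE.trans h'.next_zE.symm
  refine ⟨rfl, rfl, rfl, State.ext' (h.next_x.trans h'.next_x.symm) hs hzI hzE ?_ ?_ ?_⟩
  · rw [h.next_ws, h'.next_ws, hs]
  · rw [h.next_yI, h'.next_yI, hzI]
  · rw [h.next_yE, h'.next_yE, hzE]

theorem existsUnique_isRunFrom (Q : QP n m p) (hP : Q.P.PosSemidef) (θ : Params)
    (hsigmaX : 0 < θ.sigmaX) (hsigmaS : 0 < θ.sigmaS) (hrhoI : 0 < θ.rhoI) (hrhoE : 0 < θ.rhoE)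
    (u : State n m p) : ∃! r : Run n m p, IsRunFrom Q θ u r := by
  choose nuI nuE t v hv using exists_isStep Q hP θ hsigmaX hsigmaS hrhoI hrhoE
  let st : ℕ → State n m p := fun k => v^[k] u
  refine ⟨⟨st, fun k => nuI (st k), fun k => nuE (st k), fun k => t (st k)⟩, ⟨rfl, fun k => ?_⟩, ?_⟩
  · have : st (k + 1) = v (st k) := Function.iterate_succ_apply' v k u
    simp only [this]
    exact hv _
  · rintro ⟨s', a', b', t'⟩ ⟨h0, hs⟩
    simp only at h0 hs
    have hst : ∀ k, s' k = st k := by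
      intro k
      induction k with
      | zero => exact h0
      | succ k ih =>
        have h1 := hs k
        rw [ih] at h1
        rw [(h1.unique hP hsigmaX hsigmaS hrhoI hrhoE (hv _)).2.2.2]
        exact (Function.iterate_succ_apply' v k u).symm
    have hall := fun k => by
      have h1 := hs k
      rw [hst k] at h1
      exact h1.unique hP hsigmaX hsigmaS hrhoI hrhoE (hv _)
    rw [Run.mk.injEq]
    exact ⟨funext hst, funext fun k => (hall k).1, funext fun k => (hall k).2.1,
      funext fun k => (hall k).2.2.1⟩

end Run

/-! ### The inner product weighted by the penalties -/

section Metric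

variable {n m p : ℕ}

/-- Multiplication by the penalty weights of the algorithm, block by block. -/
def weight (θ : Params) (v : Block n m p) : Block n m p :=
  (θ.sigmaX • v.x, θ.sigmaS • v.s, θ.rhoI • v.zI, θ.rhoE • v.zE)

/-- The inner product weighted by the penalties of the algorithm. -/
noncomputable def weightedDot (n m p : ℕ) (θ : Params) :
    Block n m p →ₗ[ℝ] Block n m p →ₗ[ℝ] ℝ :=
  LinearMap.mk₂ ℝ (fun u v => Block.dot u (weight θ v))
    (fun u u' v => by
      simp only [Block.dot, Block.x_add, Block.s_add, Block.zI_add, Block.zE_add, add_dotProduct]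
      ring)
    (fun c u v => by
      simp only [Block.dot, Block.x_smul, Block.s_smul, Block.zI_smul, Block.zE_smul,
        smul_dotProduct, smul_eq_mul]
      ring)
    (fun u v v' => by
      simp only [Block.dot, weight, Block.x_mk, Block.s_mk, Block.zI_mk, Block.zE_mk, Block.x_add,
        Block.s_add, Block.zI_add, Block.zE_add, smul_add, dotProduct_add]
      ring)
    (fun c u v => by
      simp only [Block.dot, weight, Block.x_mk, Block.s_mk, Block.zI_mk, Block.zE_mk,
        Block.x_smul, Block.s_smul, Block.zI_smul, Block.zE_smul, dotProduct_smul, smul_eq_mul]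
      ring)

theorem weightedDot_apply (θ : Params) (u v : Block n m p) :
    weightedDot n m p θ u v = Block.dot u (weight θ v) := rfl

theorem weightedDot_eq (θ : Params) (u v : Block n m p) : weightedDot n m p θ u v =
    θ.sigmaX * (u.x ⬝ᵥ v.x) + θ.sigmaS * (u.s ⬝ᵥ v.s) + θ.rhoI * (u.zI ⬝ᵥ v.zI)
      + θ.rhoE * (u.zE ⬝ᵥ v.zE) := by
  simp only [weightedDot_apply, Block.dot, weight, Block.x_mk, Block.s_mk, Block.zI_mk,
    Block.zE_mk, dotProduct_smul, smul_eq_mul]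

theorem weight_sub (θ : Params) (u v : Block n m p) :
    weight θ (u - v) = weight θ u - weight θ v :=
  Block.ext (smul_sub _ _ _) (smul_sub _ _ _) (smul_sub _ _ _) (smul_sub _ _ _)

theorem weight_neg (θ : Params) (v : Block n m p) : weight θ (-v) = -weight θ v :=
  Block.ext (smul_neg _ _) (smul_neg _ _) (smul_neg _ _) (smul_neg _ _)

@[fun_prop] theorem continuous_weight (θ : Params) :
    Continuous (weight θ : Block n m p → Block n m p) := by
  unfold weight; fun_prop

theorem weightedDot_pos {θ : Params} (hsigmaX : 0 < θ.sigmaX) (hsigmaS : 0 < θ.sigmaS)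
    (hrhoI : 0 < θ.rhoI) (hrhoE : 0 < θ.rhoE) {v : Block n m p} (hv : v ≠ 0) :
    0 < weightedDot n m p θ v v := by
  rw [weightedDot_eq]
  have h1 := mul_nonneg hsigmaX.le (self_dotProduct_nonneg v.x)
  have h2 := mul_nonneg hsigmaS.le (self_dotProduct_nonneg v.s)
  have h3 := mul_nonneg hrhoI.le (self_dotProduct_nonneg v.zI)
  have h4 := mul_nonneg hrhoE.le (self_dotProduct_nonneg v.zE)
  refine lt_of_le_of_ne (by linarith) fun h => hv ?_
  have e1 : θ.sigmaX * (v.x ⬝ᵥ v.x) = 0 := by linarith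
  have e2 : θ.sigmaS * (v.s ⬝ᵥ v.s) = 0 := by linarith
  have e3 : θ.rhoI * (v.zI ⬝ᵥ v.zI) = 0 := by linarith
  have e4 : θ.rhoE * (v.zE ⬝ᵥ v.zE) = 0 := by linarith
  rw [mul_eq_zero_iff_left (by positivity), dotProduct_self_eq_zero] at e1 e2 e3 e4
  exact Block.ext e1 e2 e3 e4

/-- The dual variable of a state divided by the penalty weights. -/
noncomputable def State.scaledDual (θ : Params) (u : State n m p) : Block n m p :=
  (0, θ.sigmaS⁻¹ • u.ws, θ.rhoI⁻¹ • u.yI, θ.rhoE⁻¹ • u.yE)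

theorem exists_weight_eq {θ : Params} (hsigmaX : 0 < θ.sigmaX) (hsigmaS : 0 < θ.sigmaS)
    (hrhoI : 0 < θ.rhoI) (hrhoE : 0 < θ.rhoE) (y : Block n m p) : ∃ w, weight θ w = y :=
  ⟨(θ.sigmaX⁻¹ • y.x, θ.sigmaS⁻¹ • y.s, θ.rhoI⁻¹ • y.zI, θ.rhoE⁻¹ • y.zE),
    Block.ext (smul_inv_smul₀ hsigmaX.ne' _) (smul_inv_smul₀ hsigmaS.ne' _)
      (smul_inv_smul₀ hrhoI.ne' _) (smul_inv_smul₀ hrhoE.ne' _)⟩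

theorem weight_scaledDual {θ : Params} (hsigmaS : 0 < θ.sigmaS)
    (hrhoI : 0 < θ.rhoI) (hrhoE : 0 < θ.rhoE) (u : State n m p) :
    weight θ (u.scaledDual θ) = u.dual :=
  Block.ext (smul_zero _) (smul_inv_smul₀ hsigmaS.ne' _)
    (smul_inv_smul₀ hrhoI.ne' _) (smul_inv_smul₀ hrhoE.ne' _)

end Metric

/-! ### One iteration as a Douglas–Rachford step -/

section Step

variable {n m p : ℕ}

/-- With `c = a + ρ⁻¹ y`, the updated multiplier is `ρ (c - z)`, and `c - z` is `c` clipped to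
`[-μ/ρ, μ/ρ]`, with the end of the interval determined by the sign of `z` when `z ≠ 0`. -/
theorem soft_subgradient {μ ρ a y : ℝ} (hμ : 0 < μ) (hρ : 0 < ρ) {z : ℝ}
    (hz : z = max (a + ρ⁻¹ * y - μ / ρ) 0 - max (-(a + ρ⁻¹ * y) - μ / ρ) 0) :
    |y + ρ * (a - z)| ≤ μ ∧ (y + ρ * (a - z)) * z = μ * |z| := by
  have e : y + ρ * (a - z) = ρ * (a + ρ⁻¹ * y - z) := by field_simp; ring
  obtain ⟨κ, hκ⟩ : ∃ κ, κ = μ / ρ := ⟨_, rfl⟩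
  have hκ0 : 0 < κ := hκ ▸ div_pos hμ hρ
  have hμ' : μ = ρ * κ := by rw [hκ]; field_simp
  rw [e]
  rw [← hκ] at hz
  generalize a + ρ⁻¹ * y = c at *
  rcases le_total c κ with h1 | h1
  · rcases le_total (-c) κ with h2 | h2
    · rw [max_eq_right (by linarith), max_eq_right (by linarith)] at hz
      rw [hz, sub_zero, sub_zero, abs_mul, abs_of_pos hρ, hμ']
      refine ⟨mul_le_mul_of_nonneg_left (abs_le.2 ⟨by linarith, h1⟩) hρ.le, by simp⟩
    · rw [max_eq_right (by linarith), max_eq_left (by linarith)] at hz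
      have e2 : c - z = -κ := by rw [hz]; ring
      rw [e2, abs_of_nonpos (by nlinarith), abs_of_nonpos (by rw [hz]; linarith), hμ']
      constructor
      · linarith
      · ring
  · rw [max_eq_left (by linarith), max_eq_right (by linarith)] at hz
    have e2 : c - z = κ := by rw [hz]; ring
    rw [e2, abs_of_nonneg (by positivity), abs_of_nonneg (by rw [hz]; linarith), hμ']
    exact ⟨le_rfl, rfl⟩

theorem IsStep.subG {Q : QP n m p} {θ : Params} (hmuI : 0 < θ.muI) (hmuE : 0 < θ.muE)
    (hsigmaS : 0 < θ.sigmaS) (hrhoI : 0 < θ.rhoI) (hrhoE : 0 < θ.rhoE) {u v : State n m p}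
    {nuI : Fin m → ℝ} {nuE : Fin p → ℝ} {t : Block n m p} (h : IsStep Q θ u nuI nuE t v) :
    SubG θ.muI θ.muE v.primal v.dual := by
  have hs : ∀ i, v.s i = max (θ.alpha * t.s i + (1 - θ.alpha) * u.s i + θ.sigmaS⁻¹ * u.ws i) 0 :=
    fun i => congrFun h.next_s i
  have hws : ∀ i, v.ws i = θ.sigmaS *
      (θ.alpha * t.s i + (1 - θ.alpha) * u.s i + θ.sigmaS⁻¹ * u.ws i - v.s i) := fun i => by
    have h1 : v.ws i = u.ws i + θ.sigmaS *
      (θ.alpha * t.s i + (1 - θ.alpha) * u.s i - v.s i) := congrFun h.next_ws i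
    rw [h1]; field_simp; ring
  have hzI := fun i => soft_subgradient (y := u.yI i) hmuI hrhoI (congrFun h.next_zI i)
  have hzE := fun i => soft_subgradient (y := u.yE i) hmuE hrhoE (congrFun h.next_zE i)
  have hyI : ∀ i, v.yI i = _ := fun i => congrFun h.next_yI i
  have hyE : ∀ i, v.yE i = _ := fun i => congrFun h.next_yE i
  refine ⟨rfl, fun i => ?_, fun i => ?_, fun i => ?_, fun i => ?_, fun i => ?_, fun i => ?_,
    fun i => ?_⟩
  · exact (le_max_right _ _).trans_eq (hs i).symm
  · change v.ws i ≤ 0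
    rw [hws i, hs i]
    exact mul_nonpos_of_nonneg_of_nonpos hsigmaS.le (sub_nonpos.2 (le_max_left _ _))
  · change v.ws i * v.s i = 0
    rw [hws i, hs i]
    rcases le_total (θ.alpha * t.s i + (1 - θ.alpha) * u.s i + θ.sigmaS⁻¹ * u.ws i) 0 with h | h
    · rw [max_eq_right h, mul_zero]
    · rw [max_eq_left h, sub_self, mul_zero, zero_mul]
  · change |v.yI i| ≤ _
    rw [hyI i]; exact (hzI i).1
  · change v.yI i * v.zI i = θ.muI * |v.zI i|
    rw [hyI i]; exact (hzI i).2
  · change |v.yE i| ≤ _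
    rw [hyE i]; exact (hzE i).1
  · change v.yE i * v.zE i = θ.muE * |v.zE i|
    rw [hyE i]; exact (hzE i).2

/-- The linear system is the optimality condition of the proximal step for `f`: the last three
components of the weighted vector are `nuI`, `-nuI` and `-nuE`. -/
theorem IsStep.subF {Q : QP n m p} {θ : Params}
    (hsigmaS : 0 < θ.sigmaS) (hrhoI : 0 < θ.rhoI) (hrhoE : 0 < θ.rhoE) {u v : State n m p}
    {nuI : Fin m → ℝ} {nuE : Fin p → ℝ} {t : Block n m p} (h : IsStep Q θ u nuI nuE t v) :
    SubF Q t (weight θ (u.primal - t - u.scaledDual θ)) := by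
  obtain ⟨h1, h2, h3⟩ := h.system
  have es : (weight θ (u.primal - t - u.scaledDual θ)).s = nuI := by
    change θ.sigmaS • (u.s - t.s - θ.sigmaS⁻¹ • u.ws) = nuI
    rw [h.tilde_s]
    ext i
    simp only [Pi.smul_apply, Pi.sub_apply, smul_eq_mul]
    field_simp; ring
  have eI : (weight θ (u.primal - t - u.scaledDual θ)).zI = -nuI := by
    change θ.rhoI • (u.zI - t.zI - θ.rhoI⁻¹ • u.yI) = -nuI
    rw [h.tilde_zI]
    ext i
    simp only [Pi.smul_apply, Pi.sub_apply, Pi.add_apply, Pi.neg_apply, smul_eq_mul]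
    field_simp; ring
  have eE : (weight θ (u.primal - t - u.scaledDual θ)).zE = -nuE := by
    change θ.rhoE • (u.zE - t.zE - θ.rhoE⁻¹ • u.yE) = -nuE
    rw [h.tilde_zE]
    ext i
    simp only [Pi.smul_apply, Pi.sub_apply, Pi.add_apply, Pi.neg_apply, smul_eq_mul]
    field_simp; ring
  refine ⟨⟨?_, ?_⟩, ?_, ?_⟩
  · rw [h.tilde_zI, h.tilde_s, sub_eq_iff_eq_add.1 h2, add_smul]
    abel
  · rw [h.tilde_zE, sub_eq_iff_eq_add.1 h3]
    abel
  · rw [es, eI]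
  · rw [es, eE, mulVec_neg, sub_neg_eq_add]
    change θ.sigmaX • (u.x - t.x - 0) = _
    rw [add_mulVec, smul_mulVec, one_mulVec] at h1
    rw [sub_zero, smul_sub, sub_eq_iff_eq_add, sub_eq_iff_eq_add.1 h1.symm]
    abel

/-- The dual update moves into the scaled dual exactly what the proximal map removes from the
over-relaxed point, so the sum does not see the nonlinearity. -/
theorem IsStep.add_scaledDual {Q : QP n m p} {θ : Params}
    (hsigmaS : 0 < θ.sigmaS) (hrhoI : 0 < θ.rhoI) (hrhoE : 0 < θ.rhoE) {u v : State n m p}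
    {nuI : Fin m → ℝ} {nuE : Fin p → ℝ} {t : Block n m p} (h : IsStep Q θ u nuI nuE t v) :
    v.primal + v.scaledDual θ
      = u.primal + u.scaledDual θ + θ.alpha • (t - u.primal) := by
  refine Block.ext ?_ ?_ ?_ ?_
  · change v.x + 0 = u.x + 0 + θ.alpha • (t.x - u.x)
    rw [h.next_x, smul_sub, sub_smul, one_smul]
    abel
  · change v.s + θ.sigmaS⁻¹ • v.ws = u.s + θ.sigmaS⁻¹ • u.ws + θ.alpha • (t.s - u.s)
    rw [h.next_ws, smul_add, inv_smul_smul₀ hsigmaS.ne', smul_sub, sub_smul, one_smul]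
    abel
  · change v.zI + θ.rhoI⁻¹ • v.yI = u.zI + θ.rhoI⁻¹ • u.yI + θ.alpha • (t.zI - u.zI)
    rw [h.next_yI, smul_add, inv_smul_smul₀ hrhoI.ne', smul_sub, sub_smul, one_smul]
    abel
  · change v.zE + θ.rhoE⁻¹ • v.yE = u.zE + θ.rhoE⁻¹ • u.yE + θ.alpha • (t.zE - u.zE)
    rw [h.next_yE, smul_add, inv_smul_smul₀ hrhoE.ne', smul_sub, sub_smul, one_smul]
    abel

end Step

end FlexQP

theorem theorem2 {n m p : ℕ} (Q : FlexQP.QP n m p) (hP : Q.P.PosSemidef)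
    (θ : FlexQP.Params)
    (hmuI : 0 < θ.muI) (hmuE : 0 < θ.muE)
    (hsigmaX : 0 < θ.sigmaX) (hsigmaS : 0 < θ.sigmaS)
    (hrhoI : 0 < θ.rhoI) (hrhoE : 0 < θ.rhoE)
    (halpha0 : 0 < θ.alpha) (halpha2 : θ.alpha < 2)
    (hbdd : ∃ B : ℝ, ∀ (x : Fin n → ℝ) (s : Fin m → ℝ), 0 ≤ s →
      B ≤ FlexQP.phi Q θ.muI θ.muE x s)
    (u : FlexQP.State n m p) :
    (∃! r : FlexQP.Run n m p, FlexQP.IsRunFrom Q θ u r) ∧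
    ∀ r : FlexQP.Run n m p, FlexQP.IsRunFrom Q θ u r →
      (∃ xt x y : FlexQP.Block n m p,
        FlexQP.IsSaddle Q θ.muI θ.muE xt x y ∧
        (0 ≤ x.s ∧ ∀ (x' : Fin n → ℝ) (s' : Fin m → ℝ), 0 ≤ s' →
          FlexQP.phi Q θ.muI θ.muE x.x x.s ≤ FlexQP.phi Q θ.muI θ.muE x' s') ∧
        Tendsto r.tilde atTop (𝓝 xt) ∧
        Tendsto (fun k => (r.state k).primal) atTop (𝓝 x) ∧
        Tendsto (fun k => (r.state k).dual) atTop (𝓝 y)) ∧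
      Tendsto (fun k => r.tilde k - (r.state (k + 1)).primal) atTop (𝓝 0) ∧
      Tendsto (fun k => (r.state k).primal - (r.state (k + 1)).primal) atTop (𝓝 0) := by
  refine ⟨FlexQP.existsUnique_isRunFrom Q hP θ hsigmaX hsigmaS hrhoI hrhoE u, ?_⟩
  rintro r ⟨-, hr⟩
  have hwc := FlexQP.continuous_weight (n := n) (m := m) (p := p) θ
  have hpair : Continuous fun a : FlexQP.Block n m p × FlexQP.Block n m p =>
      (a.1, FlexQP.weight θ a.2) := by fun_prop
  obtain ⟨a, b, hG, hF, hx, hw, ht⟩ := FlexQP.tendsto_douglasRachford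
    (FlexQP.weightedDot n m p θ)
    (fun u v => by simp only [FlexQP.weightedDot_eq, dotProduct_comm])
    (by simp only [FlexQP.weightedDot_eq]; fun_prop)
    (fun v hv => FlexQP.weightedDot_pos hsigmaX hsigmaS hrhoI hrhoE hv)
    -- Dividing dual vectors by the weights turns Euclidean monotonicity of the subdifferentials
    -- into monotonicity for the weighted form.
    (F := {a | FlexQP.SubF Q a.1 (FlexQP.weight θ a.2)})
    (G := {a | FlexQP.SubG θ.muI θ.muE a.1 (FlexQP.weight θ a.2)})
    ((FlexQP.isClosed_subF Q).preimage hpair)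
    ((FlexQP.isClosed_subG θ.muI θ.muE).preimage hpair)
    (fun a ha b hb => by
      rw [FlexQP.weightedDot_apply, FlexQP.weight_sub]; exact ha.monotone hP hb)
    (fun a ha b hb => by
      rw [FlexQP.weightedDot_apply, FlexQP.weight_sub]; exact ha.monotone hb)
    halpha0 halpha2
    -- The arbitrary starting state need not lie on the graph of `∂g`; every later state does, hence
    -- the shift by one.
    (x := fun k => (r.state (k + 1)).primal) (w := fun k => (r.state (k + 1)).scaledDual θ)
    (t := fun k => r.tilde (k + 1))
    (fun k => by
      rw [Set.mem_ofPred_eq, FlexQP.weight_scaledDual hsigmaS hrhoI hrhoE]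
      exact (hr k).subG hmuI hmuE hsigmaS hrhoI hrhoE)
    (fun k => (hr (k + 1)).subF hsigmaS hrhoI hrhoE)
    (fun k => (hr (k + 1)).add_scaledDual hsigmaS hrhoI hrhoE)
    (by
      obtain ⟨x, y, hG, hF⟩ := FlexQP.exists_subgradients Q hP hmuI hmuE hbdd
      obtain ⟨w, rfl⟩ := FlexQP.exists_weight_eq hsigmaX hsigmaS hrhoI hrhoE y
      refine ⟨x, w, hG, ?_⟩
      rw [Set.mem_ofPred_eq, FlexQP.weight_neg]
      exact hF)
  rw [Set.mem_ofPred_eq] at hG hF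
  rw [FlexQP.weight_neg] at hF
  simp only at hG hF
  have hx' : Tendsto (fun k => (r.state k).primal) atTop (𝓝 a) := (tendsto_add_atTop_iff_nat 1).1 hx
  have ht' : Tendsto r.tilde atTop (𝓝 a) := (tendsto_add_atTop_iff_nat 1).1 ht
  refine ⟨⟨a, a, FlexQP.weight θ b, FlexQP.isSaddle_of_subgradients hP hG hF,
    ⟨hG.s_nonneg, FlexQP.phi_le_of_subgradients hP hG hF⟩, ht', hx', ?_⟩, ?_, ?_⟩
  · refine (tendsto_add_atTop_iff_nat 1).1 (((hwc.tendsto b).comp hw).congr fun k => ?_)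
    exact FlexQP.weight_scaledDual hsigmaS hrhoI hrhoE _
  · simpa using ht'.sub hx
  · simpa using hx'.sub hx
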